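/- **Conventions.** Let $A,B$ be primitive $N\times N$ matrices with nonnegative integer entries whose characteristic polynomials are irreducible over $\mathbb Z$ (so $A,B$ are nonsingular). For such a matrix $A$ let $\lambda_A$ be its Perron–Frobenius eigenvalue, let $$G(A)=\bigcup_{n\ge 0}A^{-n}(\mathbb Z^N)\subset\mathbb Q^N,\qquad G(A)_+=\bigcup_{n\ge0}A^{-n}(\mathbb Z_+^N)$$ be its dimension group (column vectors) and its positive cone; $G(A)$ is a $\mathbb Z[1/\lambda_A]$-module on which $f(1/\lambda_A)$ acts as $f(A^{-1})$ for $f\in\mathbb Z[X]$. Let $v_A$ be a left Perron–Frobenius eigenvector of $A$ with positive components in $\mathbb Q[\lambda_A]$ (it can be chosen with components in $\mathbb Z[1/\lambda_A]$), and $\tau_A(g)=\langle v_A, g\rangle$, $g\in G(A)$, the corresponding trace; its range $\operatorname{ran}\tau_A\subset\mathbb R$ carries the order of $\mathbb R$. $A$ and $B$ are *$C^*$-equivalent* if there are positive integers $n_k,m_k$ and nonnegative integer matrices $J(k),K(k)$, $k\ge1$, with $A^{n_k}=K(k)J(k)$ and $B^{m_k}=J(k+1)K(k)$ for all $k$. They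 are *shift equivalent* (over $\mathbb Z_+$) if there are nonnegative integer matrices $R,S$ and $l\ge1$ with $AR=RB$, $SA=BS$, $RS=A^l$, $SR=B^l$; over $\mathbb Z$ if $R,S$ are only required to be integer matrices. **Theorem.** $A$ and $B$ are $C^*$-equivalent if and only if the following three conditions all hold: 1. $\mathbb Q[\lambda_A]=\mathbb Q[\lambda_B]$ as subfields of $\mathbb R$; 2. $\lambda_A$ and $\lambda_B$ are divisible by the same algebraic primes, i.e. lie in the same nonzero prime ideals of the ring of algebraic integers of the field $\mathbb Q[\lambda_A,\lambda_B]$ (which is $\mathbb Q[\lambda_A]$ when (1) holds); 3. $G(A)$ and $G(B)$ are isomorphic as modules over $\mathbb Z[1/\lambda_A]\cap\mathbb Z[1/\lambda_B]$ (equivalently, in the presence of (1) and (2): over some subring of it whose additive group has rank $N$). Each of $A$, $B$ has its dimension group isomorphic, through the trace, to the range of the trace: $\tau_A$ is an isomorphism of $\mathbb Z[1/\lambda_A]$-modules from $G(A)$ onto $\operatorname{ran}\tau_A$, which is a fractional ideal of $\mathbb Z[1/\lambda_A]$, and is contained in $\mathbb Z[1/\lambda_A]$ if the components of $v_A$ are;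 likewise for $B$. Moreover, the conjunction of (1), (2), (3) is equivalent to 4. $\operatorname{ran}\tau_A$ and $\operatorname{ran}\tau_B$ are isomorphic as ordered additive groups (for any choice of $v_A$, $v_B$ as above). If in addition the characteristic polynomials of $A$ and $B$ are equal, then the following are equivalent: $A$ and $B$ are $C^*$-equivalent; $(G(A),G(A)_+)$ and $(G(B),G(B)_+)$ are isomorphic as ordered groups; $A$ and $B$ are shift equivalent over $\mathbb Z_+$; $A$ and $B$ are shift equivalent over $\mathbb Z$. Finally, taking powers preserves the module and the ideal: for every $k\ge1$, $G(A^k)=G(A)$, and every positive left Perron–Frobenius eigenvector $v$ of $A$ is one of $A^k$ and defines the same trace range for $A^k$ as for $A$. -/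

import Mathlib

open scoped Matrix

noncomputable section

/-- All entries of an integer matrix are nonnegative, i.e. it is a matrix over `ℤ₊`. -/
def NonnegEntries {N : ℕ} (M : Matrix (Fin N) (Fin N) ℤ) : Prop :=
  ∀ i j, 0 ≤ M i j

/-- `C*`-equivalence: there are sequences of positive exponents `n k`, `m k` and of nonnegative
integer matrices `J k`, `K k` such that the two stationary diagrams intertwine:
`A ^ n k = K k * J k` and `B ^ m k = J (k + 1) * K k`. -/
def CStarEquiv {N : ℕ} (A B : Matrix (Fin N) (Fin N) ℤ) : Prop :=
  ∃ (n m : ℕ → ℕ) (J K : ℕ → Matrix (Fin N) (Fin N) ℤ),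
    (∀ k, 0 < n k) ∧ (∀ k, 0 < m k) ∧
    (∀ k, NonnegEntries (J k)) ∧ (∀ k, NonnegEntries (K k)) ∧
    ∀ k, A ^ n k = K k * J k ∧ B ^ m k = J (k + 1) * K k

/-- The equations of a shift equivalence of lag `l` between `A` and `B`. -/
def IsShiftEquivalence {N : ℕ} (A B R S : Matrix (Fin N) (Fin N) ℤ) (l : ℕ) : Prop :=
  0 < l ∧ A * R = R * B ∧ S * A = B * S ∧ R * S = A ^ l ∧ S * R = B ^ l

/-- Shift equivalence over `ℤ₊`. -/
def ShiftEquiv {N : ℕ} (A B : Matrix (Fin N) (Fin N) ℤ) : Prop :=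
  ∃ R S l, NonnegEntries R ∧ NonnegEntries S ∧ IsShiftEquivalence A B R S l

/-- Shift equivalence over `ℤ`. -/
def ShiftEquivInt {N : ℕ} (A B : Matrix (Fin N) (Fin N) ℤ) : Prop :=
  ∃ R S l, IsShiftEquivalence A B R S l

/-- The Perron–Frobenius eigenvalue, as the spectral radius of the complex matrix. -/
def perronRoot {N : ℕ} (A : Matrix (Fin N) (Fin N) ℤ) : ℝ :=
  (spectralRadius ℂ (A.map (Int.cast : ℤ → ℂ))).toReal

/-- The field `ℚ[λ] ⊆ ℝ` generated by the Perron–Frobenius eigenvalue. -/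
def perronField {N : ℕ} (A : Matrix (Fin N) (Fin N) ℤ) : IntermediateField ℚ ℝ :=
  IntermediateField.adjoin ℚ {perronRoot A}

/-- The ring `ℤ[1/λ] ⊆ ℝ`, where `λ` is the Perron–Frobenius eigenvalue. -/
def perronRing {N : ℕ} (A : Matrix (Fin N) (Fin N) ℤ) : Subalgebra ℤ ℝ :=
  Algebra.adjoin ℤ {(perronRoot A)⁻¹}

/-- The nonzero primes of the ring of algebraic integers of `F` that divide `a`
(meaning that `a` is an element of that ring and of the prime ideal). -/
def primesDividing (F : IntermediateField ℚ ℝ) (a : ℝ) :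
    Set (Ideal (NumberField.RingOfIntegers F)) :=
  {P | P.IsPrime ∧ P ≠ ⊥ ∧
    ∃ x ∈ P, (algebraMap (NumberField.RingOfIntegers F) F x : ℝ) = a}

/-- The Perron–Frobenius eigenvalues of `A` and `B` are divisible by the same algebraic primes.
The primes are those of the field generated by both eigenvalues, which is `ℚ[λ]` as soon as the
two eigenvalues generate the same field. -/
def SameAlgebraicPrimes {N : ℕ} (A B : Matrix (Fin N) (Fin N) ℤ) : Prop :=
  primesDividing (perronField A ⊔ perronField B) (perronRoot A) =
    primesDividing (perronField A ⊔ perronField B) (perronRoot B)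

/-- `A` as a rational matrix. -/
def ratMat {N : ℕ} (A : Matrix (Fin N) (Fin N) ℤ) : Matrix (Fin N) (Fin N) ℚ :=
  A.map (Int.cast : ℤ → ℚ)

/-- The dimension group `G(A) = ⋃ₙ A⁻ⁿ(ℤᴺ) ⊆ ℚᴺ` of a nonsingular `A` (column vectors). -/
def dimGroup {N : ℕ} (A : Matrix (Fin N) (Fin N) ℤ) : Submodule ℤ (Fin N → ℚ) where
  carrier := {g | ∃ (n : ℕ) (z : Fin N → ℤ), ratMat A ^ n *ᵥ g = fun i => (z i : ℚ)}
  zero_mem' := ⟨0, 0, by ext i; simp⟩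
  add_mem' := by
    rintro a b ⟨n, z, hz⟩ ⟨m, w, hw⟩
    refine ⟨n + m, (A ^ m) *ᵥ z + (A ^ n) *ᵥ w, ?_⟩
    have key : ∀ (k : ℕ) (u : Fin N → ℤ),
        ratMat A ^ k *ᵥ (fun i => (u i : ℚ)) = fun i => (((A ^ k) *ᵥ u) i : ℚ) := by
      intro k u
      have h : ratMat A ^ k = (A ^ k).map (Int.castRingHom ℚ) := by
        rw [Matrix.map_pow]; rfl
      ext i
      rw [h]
      simp [Matrix.mulVec, dotProduct]
    have h1 : ratMat A ^ (n + m) *ᵥ a = fun i => (((A ^ m) *ᵥ z) i : ℚ) := by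
      rw [add_comm, pow_add, ← Matrix.mulVec_mulVec, hz, key]
    have h2 : ratMat A ^ (n + m) *ᵥ b = fun i => (((A ^ n) *ᵥ w) i : ℚ) := by
      rw [pow_add, ← Matrix.mulVec_mulVec, hw, key]
    rw [Matrix.mulVec_add, h1, h2]
    ext i
    simp
  smul_mem' := by
    rintro c g ⟨n, z, hz⟩
    refine ⟨n, c • z, ?_⟩
    rw [Matrix.mulVec_smul, hz]
    ext i
    simp

/-- The positive cone of the dimension group: `⋃ₙ A⁻ⁿ(ℤ₊ᴺ)`. -/
def DimNonneg {N : ℕ} (A : Matrix (Fin N) (Fin N) ℤ) (g : dimGroup A) : Prop :=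
  ∃ (n : ℕ) (z : Fin N → ℤ), (∀ i, 0 ≤ z i) ∧
    ratMat A ^ n *ᵥ (g : Fin N → ℚ) = fun i => (z i : ℚ)

/-- Isomorphism of the dimension groups as ordered groups. -/
def OrderedDimIso {N : ℕ} (A B : Matrix (Fin N) (Fin N) ℤ) : Prop :=
  ∃ φ : dimGroup A ≃+ dimGroup B, ∀ g, DimNonneg A g ↔ DimNonneg B (φ g)

lemma inv_mulVec_mem_dimGroup {N : ℕ} (A : Matrix (Fin N) (Fin N) ℤ) (g : Fin N → ℚ)
    (hg : g ∈ dimGroup A) : (ratMat A)⁻¹ *ᵥ g ∈ dimGroup A := by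
  obtain ⟨n, z, hz⟩ := hg
  by_cases h : IsUnit (ratMat A).det
  · refine ⟨n + 1, z, ?_⟩
    rw [Matrix.mulVec_mulVec, pow_succ, Matrix.mul_assoc, Matrix.mul_nonsing_inv _ h,
      Matrix.mul_one, hz]
  · rw [Matrix.nonsing_inv_apply_not_isUnit _ h, Matrix.zero_mulVec]
    exact (dimGroup A).zero_mem

/-- The map `g ↦ A⁻¹ g` of the dimension group. -/
def invEnd {N : ℕ} (A : Matrix (Fin N) (Fin N) ℤ) : Module.End ℤ (dimGroup A) :=
  LinearMap.restrict ((Matrix.mulVecLin (ratMat A)⁻¹).restrictScalars ℤ)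
    (fun g hg => inv_mulVec_mem_dimGroup A g hg)

/-- The dimension groups of `A` and `B` are isomorphic as modules over the subring `R` of
`ℤ[1/λ_A] ∩ ℤ[1/λ_B]`. The element `f(1/λ_A)` of `ℤ[1/λ_A]`, for `f ∈ ℤ[X]`, acts on `G(A)` as
`f(A⁻¹)`, and likewise for `B`; so an isomorphism `φ` of abelian groups is `R`-linear if it
intertwines `f(A⁻¹)` with `h(B⁻¹)` whenever `f(1/λ_A) = h(1/λ_B)` is an element of `R`. -/
def DimModuleIso {N : ℕ} (A B : Matrix (Fin N) (Fin N) ℤ) (R : Subalgebra ℤ ℝ) : Prop :=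
  ∃ φ : dimGroup A ≃+ dimGroup B, ∀ f h : Polynomial ℤ,
    Polynomial.aeval (perronRoot A)⁻¹ f = Polynomial.aeval (perronRoot B)⁻¹ h →
    Polynomial.aeval (perronRoot A)⁻¹ f ∈ R →
    ∀ g : dimGroup A,
      φ (Polynomial.aeval (invEnd A) f g) = Polynomial.aeval (invEnd B) h (φ g)

/-- `v` is a left (row) Perron–Frobenius eigenvector of `A`, with positive components. -/
structure IsPerronRow {N : ℕ} (A : Matrix (Fin N) (Fin N) ℤ) (v : Fin N → ℝ) : Prop where
  pos : ∀ i, 0 < v i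
  eigen : v ᵥ* A.map (Int.cast : ℤ → ℝ) = perronRoot A • v

/-- The pairing `g ↦ ⟨v, g⟩` of a real row vector with rational column vectors. -/
def tracePairing {N : ℕ} (v : Fin N → ℝ) : (Fin N → ℚ) →ₗ[ℤ] ℝ where
  toFun g := v ⬝ᵥ fun i => (g i : ℝ)
  map_add' a b := by
    simp [dotProduct, mul_add, Finset.sum_add_distrib]
  map_smul' c a := by
    simp only [dotProduct, Finset.smul_sum]
    refine Finset.sum_congr rfl fun i _ => ?_
    simp
    ring

/-- The range `τ(G(A)) ⊆ ℝ` of the trace `τ(g) = ⟨v, g⟩`, an additive subgroup of `ℝ`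
with the order inherited from `ℝ`. -/
def traceRange {N : ℕ} (A : Matrix (Fin N) (Fin N) ℤ) (v : Fin N → ℝ) : AddSubgroup ℝ :=
  ((dimGroup A).map (tracePairing v)).toAddSubgroup

/-- The range of the trace is a fractional ideal `I` of `ℤ[1/λ]`, which is an integral ideal when
`v` has its components in `ℤ[1/λ]`, and the trace is an isomorphism of `ℤ[1/λ]`-modules
from `G(A)` onto `I`. -/
def TraceIsModuleIso {N : ℕ} (A : Matrix (Fin N) (Fin N) ℤ) (v : Fin N → ℝ) : Prop :=
  ∃ (I : FractionalIdeal (nonZeroDivisors (perronRing A)) ℝ) (e : dimGroup A ≃+ I),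
    (∀ x : ℝ, x ∈ I ↔ x ∈ traceRange A v) ∧
    ((∀ i, v i ∈ perronRing A) → I ≤ 1) ∧
    (∀ g, (e g : ℝ) = tracePairing v (g : Fin N → ℚ)) ∧
    ∀ (f : Polynomial ℤ) (g : dimGroup A),
      (e (Polynomial.aeval (invEnd A) f g) : ℝ) =
        Polynomial.aeval (perronRoot A)⁻¹ f * (e g : ℝ)

end

open scoped Matrix

namespace Matrix

/-! ### Perron–Frobenius theory for primitive real matrices. -/

section PerronFrobenius

variable {n : Type*} [Fintype n]

/-! Irreducibility gives `λ` degree `N` over `ℚ`, so for `v` with components in `ℚ[λ]` the trace is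
a surjection `ℚᴺ → ℚ[λ]` of `ℚ`-spaces of equal dimension, hence injective
(`IsPerronRow.tracePairing_injective`). Everything can then be read off in `ℝ`: the matrix acts as
multiplication by `λ`, an integer matrix is determined by its action on the eigenrow
(`IsPerronRow.matrix_ext`), and by Perron–Frobenius the positive cone is where the trace is
nonnegative (`IsPerronRow.dimNonneg_iff`).

The hub is `TraceScaled` with `c > 0`: an isomorphism of dimension groups that multiplies the trace
by `c`. Order isomorphisms have this form because homomorphisms to `ℝ` inducing the same order are
proportional (`AddMonoidHom.exists_pos_eq_mul`). Module isomorphisms over a ring of full rank have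
it up to sign, because the dimension group has rank one over such a ring
(`DimModuleIso.exists_traceScaled`).

A `C*`-equivalence induces an order isomorphism by its first matrix `J 0`. Conversely, a scaling is
realized on high levels by nonnegative integer matrices (`TraceScaled.exists_matrix`), and a
back-and-forth choice of levels gives the two sequences. A scaling also carries one trace range onto
the other, so the fields agree and each of `1/λ_A`, `1/λ_B` acts on both ranges; the determinant
trick then makes each eigenvalue divide a power of the other, whence the same primes. If the
characteristic polynomials agree, the eigenvalues agree and the same matrices form a shift
equivalence. -/

lemma mulVec_nonneg_of_nonneg {M : Matrix n n ℝ} (hM : ∀ i j, 0 ≤ M i j) {x : n → ℝ}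
    (hx : ∀ i, 0 ≤ x i) (i : n) : 0 ≤ (M *ᵥ x) i :=
  Finset.sum_nonneg fun j _ => mul_nonneg (hM i j) (hx j)

lemma mulVec_pos_of_pos {M : Matrix n n ℝ} (hM : ∀ i j, 0 < M i j) {x : n → ℝ}
    (hx : ∀ i, 0 ≤ x i) (hx0 : x ≠ 0) (i : n) : 0 < (M *ᵥ x) i := by
  obtain ⟨j, hj⟩ := Function.ne_iff.1 hx0
  exact Finset.sum_pos' (fun j _ => mul_nonneg (hM i j).le (hx j))
    ⟨j, Finset.mem_univ j, mul_pos (hM i j) (lt_of_le_of_ne (hx j) (Ne.symm hj))⟩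

variable [DecidableEq n]

lemma pow_mulVec_eigen {M : Matrix n n ℝ} {t : ℝ} {u : n → ℝ} (h : M *ᵥ u = t • u) (k : ℕ) :
    M ^ k *ᵥ u = t ^ k • u := by
  induction k with
  | zero => simp
  | succ k ih => rw [pow_succ, ← mulVec_mulVec, h, mulVec_smul, ih, smul_smul, pow_succ']

lemma vecMul_pow_eigen {M : Matrix n n ℝ} {t : ℝ} {v : n → ℝ} (h : v ᵥ* M = t • v) (k : ℕ) :
    v ᵥ* M ^ k = t ^ k • v := by
  induction k with
  | zero => simp
  | succ k ih => rw [pow_succ, ← vecMul_vecMul, ih, smul_vecMul, h, smul_smul, pow_succ]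

/-- A primitive matrix has a positive right eigenvector with positive eigenvalue. -/
theorem IsPrimitive.exists_pos_mulVec_eq [Nonempty n] {M : Matrix n n ℝ} (hM : M.IsPrimitive) :
    ∃ t : ℝ, 0 < t ∧ ∃ u : n → ℝ, (∀ i, 0 < u i) ∧ M *ᵥ u = t • u := by
  obtain ⟨k, hk0, hk⟩ := hM.exists_pos_pow
  -- Collatz–Wielandt: maximize `t` subject to `t x ≤ M x` on the simplex. Pairs `(x, t)` form a
  -- compact set.
  let S : Set ((n → ℝ) × ℝ) :=
    {p | p.1 ∈ stdSimplex ℝ n ∧ 0 ≤ p.2 ∧ ∀ i, p.2 * p.1 i ≤ (M *ᵥ p.1) i}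
  have hSsub : S ⊆ stdSimplex ℝ n ×ˢ Set.Icc (0 : ℝ) (∑ i, ∑ j, M i j) := by
    rintro ⟨x, t⟩ ⟨hx, ht, h⟩
    refine ⟨hx, ht, ?_⟩
    calc t = ∑ i, t * x i := by rw [← Finset.mul_sum, hx.2, mul_one]
      _ ≤ ∑ i, (M *ᵥ x) i := Finset.sum_le_sum fun i _ => h i
      _ ≤ ∑ i, ∑ j, M i j := Finset.sum_le_sum fun i _ => Finset.sum_le_sum fun j _ =>
          mul_le_of_le_one_right (hM.nonneg i j)
            (hx.2 ▸ Finset.single_le_sum (fun l _ => hx.1 l) (Finset.mem_univ j))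
  have hSclosed : IsClosed S := by
    refine IsClosed.inter ((isClosed_stdSimplex ℝ n).preimage continuous_fst)
      (IsClosed.inter (isClosed_le continuous_const continuous_snd) ?_)
    have : {p : (n → ℝ) × ℝ | ∀ i, p.2 * p.1 i ≤ (M *ᵥ p.1) i} =
        ⋂ i, {p : (n → ℝ) × ℝ | p.2 * p.1 i ≤ (M *ᵥ p.1) i} := by ext; simp
    change IsClosed {p : (n → ℝ) × ℝ | ∀ i, p.2 * p.1 i ≤ (M *ᵥ p.1) i}
    rw [this]
    refine isClosed_iInter fun i => isClosed_le (by fun_prop) ?_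
    simp only [mulVec, dotProduct]
    fun_prop
  have hScomp : IsCompact S :=
    ((isCompact_stdSimplex ℝ n).prod isCompact_Icc).of_isClosed_subset hSclosed hSsub
  have hSne : S.Nonempty := by
    obtain ⟨i⟩ := ‹Nonempty n›
    refine ⟨(Pi.single i 1, 0), single_mem_stdSimplex ℝ i, le_rfl, fun j => ?_⟩
    rw [zero_mul]
    exact mulVec_nonneg_of_nonneg hM.nonneg (single_mem_stdSimplex ℝ i).1 j
  obtain ⟨⟨x, t⟩, ⟨hx, ht, hxt⟩, hmax⟩ := hScomp.exists_isMaxOn hSne continuous_snd.continuousOn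
  simp only at hx ht hxt
  have hx0 : x ≠ 0 := by
    rintro rfl
    simpa using hx.2
  have hz : ∀ i, 0 < (M ^ k *ᵥ x) i := mulVec_pos_of_pos hk hx.1 hx0
  -- Otherwise `M ^ k` turns the nonzero defect `M x - t x ≥ 0` into a strictly positive vector, and
  -- the normalized `M ^ k x` admits a larger `t`.
  have heq : M *ᵥ x = t • x := by
    by_contra hne
    have hy : ∀ i, 0 < (M ^ k *ᵥ (M *ᵥ x - t • x)) i :=
      mulVec_pos_of_pos hk (fun i => by simpa using hxt i) (sub_ne_zero.2 hne)
    set z := M ^ k *ᵥ x with hzdef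
    have hcomm : M ^ k *ᵥ (M *ᵥ x - t • x) = M *ᵥ z - t • z := by
      rw [mulVec_sub, mulVec_smul, hzdef, mulVec_mulVec, mulVec_mulVec, ← pow_succ, ← pow_succ']
    rw [hcomm] at hy
    obtain ⟨i₀, hi₀⟩ := Finite.exists_min fun i => (M *ᵥ z - t • z) i / z i
    set ε := (M *ᵥ z - t • z) i₀ / z i₀
    have hε : 0 < ε := div_pos (hy i₀) (hz i₀)
    set s := ∑ i, z i
    have hs : 0 < s := Finset.sum_pos (fun i _ => hz i) Finset.univ_nonempty
    have hmem : (s⁻¹ • z, t + ε) ∈ S := by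
      refine ⟨⟨fun i => ?_, ?_⟩, by positivity, fun i => ?_⟩
      · exact mul_nonneg (inv_nonneg.2 hs.le) (hz i).le
      · simp only [Pi.smul_apply, smul_eq_mul, ← Finset.mul_sum]
        exact inv_mul_cancel₀ hs.ne'
      · have h1 := hi₀ i
        rw [le_div_iff₀ (hz i)] at h1
        simp only [Pi.sub_apply, Pi.smul_apply, smul_eq_mul, mulVec_smul] at h1 ⊢
        have h2 : (t + ε) * z i ≤ (M *ᵥ z) i := by
          have : ε * z i ≤ (M *ᵥ z) i - t * z i := h1
          linarith
        calc (t + ε) * (s⁻¹ * z i) = s⁻¹ * ((t + ε) * z i) := by ring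
          _ ≤ s⁻¹ * (M *ᵥ z) i := mul_le_mul_of_nonneg_left h2 (inv_nonneg.2 hs.le)
    have := hmax hmem
    change t + ε ≤ t at this
    linarith
  have hpow := pow_mulVec_eigen heq k
  have hpos : ∀ i, 0 < t ^ k * x i := fun i => by
    have := hz i
    rw [hpow] at this
    exact this
  have hxpos : ∀ i, 0 < x i := fun i => pos_of_mul_pos_right (hpos i) (pow_nonneg ht k)
  refine ⟨t, lt_of_le_of_ne ht ?_, x, hxpos, heq⟩
  rintro rfl
  obtain ⟨i⟩ := ‹Nonempty n›
  simpa [zero_pow hk0.ne'] using hpos i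

lemma IsPrimitive.transpose {M : Matrix n n ℝ} (hM : M.IsPrimitive) : Mᵀ.IsPrimitive := by
  obtain ⟨k, hk0, hk⟩ := hM.exists_pos_pow
  refine ⟨fun i j => hM.nonneg j i, k, hk0, fun i j => ?_⟩
  rw [← transpose_pow]
  exact hk j i

/-- A primitive matrix has positive left and right eigenvectors with the same eigenvalue. -/
theorem IsPrimitive.exists_pos_eigenvectors [Nonempty n] {M : Matrix n n ℝ} (hM : M.IsPrimitive) :
    ∃ t : ℝ, 0 < t ∧ ∃ u v : n → ℝ, (∀ i, 0 < u i) ∧ (∀ i, 0 < v i) ∧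
      M *ᵥ u = t • u ∧ v ᵥ* M = t • v := by
  obtain ⟨t, ht, u, hu, hMu⟩ := hM.exists_pos_mulVec_eq
  obtain ⟨s, hs, v, hv, hMv⟩ := hM.transpose.exists_pos_mulVec_eq
  rw [mulVec_transpose] at hMv
  have hvu : 0 < v ⬝ᵥ u :=
    Finset.sum_pos (fun i _ => mul_pos (hv i) (hu i)) Finset.univ_nonempty
  -- Evaluating `v M u` in two ways identifies the left and right eigenvalues.
  have h : s * (v ⬝ᵥ u) = t * (v ⬝ᵥ u) := by
    rw [← smul_eq_mul, ← smul_dotProduct, ← hMv, ← dotProduct_mulVec, hMu, dotProduct_smul,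
      smul_eq_mul]
  obtain rfl := mul_right_cancel₀ hvu.ne' h
  exact ⟨s, hs, u, v, hu, hv, hMu, hMv⟩

/-- Powers of a positive matrix contract the kernel of the left Perron–Frobenius eigenvector. -/
theorem exists_abs_pow_mulVec_le [Nonempty n] {P : Matrix n n ℝ} (hP : ∀ i j, 0 < P i j)
    {t : ℝ} {u v : n → ℝ} (hu : ∀ i, 0 < u i) (hv : ∀ i, 0 < v i)
    (hPu : P *ᵥ u = t • u) (hPv : v ᵥ* P = t • v) :
    ∃ r : ℝ, 0 ≤ r ∧ r < t ∧ ∀ x : n → ℝ, v ⬝ᵥ x = 0 → ∃ s : ℝ, 0 ≤ s ∧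
      ∀ (k : ℕ) (i : n), |(P ^ k *ᵥ x) i| ≤ s * r ^ k * u i := by
  -- With this `δ`, the matrix `P - δ u vᵀ` is still nonnegative, agrees with `P` on the kernel of
  -- `v`, and has `u` as eigenvector with the smaller eigenvalue `r = t - δ ⟨v, u⟩`.
  obtain ⟨⟨i₀, j₀⟩, hmin⟩ := Finite.exists_min fun p : n × n => P p.1 p.2 / (u p.1 * v p.2)
  set δ := P i₀ j₀ / (u i₀ * v j₀)
  have hδ : 0 < δ := div_pos (hP _ _) (mul_pos (hu _) (hv _))
  have hQ : ∀ i j, 0 ≤ P i j - δ * (u i * v j) := fun i j => by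
    have := hmin (i, j)
    rw [le_div_iff₀ (mul_pos (hu i) (hv j))] at this
    exact sub_nonneg.2 this
  have hvu : 0 < v ⬝ᵥ u :=
    Finset.sum_pos (fun i _ => mul_pos (hv i) (hu i)) Finset.univ_nonempty
  have hQu : ∀ i, ∑ j, (P i j - δ * (u i * v j)) * u j = (t - δ * (v ⬝ᵥ u)) * u i := fun i => by
    have h1 : ∑ j, P i j * u j = t * u i := congrFun hPu i
    simp only [sub_mul, Finset.sum_sub_distrib, h1, dotProduct, Finset.mul_sum, Finset.sum_mul]
    congr 1
    exact Finset.sum_congr rfl fun j _ => by ring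
  refine ⟨t - δ * (v ⬝ᵥ u), ?_, by nlinarith [mul_pos hδ hvu], fun x hx => ?_⟩
  · obtain ⟨i⟩ := ‹Nonempty n›
    refine nonneg_of_mul_nonneg_left ?_ (hu i)
    rw [← hQu i]
    exact Finset.sum_nonneg fun j _ => mul_nonneg (hQ i j) (hu j).le
  -- The constant `s` is the sup norm of `x` weighted by `u`; each step multiplies the bound on this
  -- norm by `r`.
  · obtain ⟨i₁, hi₁⟩ := Finite.exists_max fun i => |x i| / u i
    refine ⟨|x i₁| / u i₁, div_nonneg (abs_nonneg _) (hu _).le, fun k => ?_⟩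
    induction k with
    | zero =>
      intro i
      have := hi₁ i
      rw [div_le_iff₀ (hu i)] at this
      simpa using this
    | succ k ih =>
      intro i
      have hker : v ⬝ᵥ (P ^ k *ᵥ x) = 0 := by
        rw [dotProduct_mulVec, vecMul_pow_eigen hPv, smul_dotProduct, hx, smul_zero]
      have hstep : (P ^ (k + 1) *ᵥ x) i =
          ∑ j, (P i j - δ * (u i * v j)) * (P ^ k *ᵥ x) j := by
        have h1 : ∑ j, δ * (u i * v j) * (P ^ k *ᵥ x) j = δ * u i * (v ⬝ᵥ (P ^ k *ᵥ x)) := by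
          rw [dotProduct, Finset.mul_sum]
          exact Finset.sum_congr rfl fun j _ => by ring
        simp only [sub_mul, Finset.sum_sub_distrib, h1, hker, mul_zero, sub_zero]
        rw [pow_succ', ← mulVec_mulVec]
        rfl
      rw [hstep]
      refine (Finset.abs_sum_le_sum_abs _ _).trans ?_
      set s := |x i₁| / u i₁
      set r := t - δ * (v ⬝ᵥ u)
      calc ∑ j, |(P i j - δ * (u i * v j)) * (P ^ k *ᵥ x) j|
          ≤ ∑ j, s * r ^ k * ((P i j - δ * (u i * v j)) * u j) :=
            Finset.sum_le_sum fun j _ => by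
              rw [abs_mul, abs_of_nonneg (hQ i j)]
              calc _ ≤ (P i j - δ * (u i * v j)) * (s * r ^ k * u j) :=
                    mul_le_mul_of_nonneg_left (ih j) (hQ i j)
                _ = _ := by ring
        _ = s * r ^ (k + 1) * u i := by rw [← Finset.mul_sum, hQu]; ring

/-- The iterates of a vector that pairs positively with the left Perron–Frobenius eigenvector
of a primitive matrix become positive. -/
theorem IsPrimitive.exists_pow_mulVec_pos [Nonempty n] {M : Matrix n n ℝ} (hM : M.IsPrimitive)
    {t : ℝ} {v : n → ℝ} (hv : ∀ i, 0 < v i) (hMv : v ᵥ* M = t • v)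
    {x : n → ℝ} (hx : 0 < v ⬝ᵥ x) : ∃ k : ℕ, ∀ i, 0 < (M ^ k *ᵥ x) i := by
  obtain ⟨t', ht', u, hu, hMu⟩ := hM.exists_pos_mulVec_eq
  have hvu : 0 < v ⬝ᵥ u :=
    Finset.sum_pos (fun i _ => mul_pos (hv i) (hu i)) Finset.univ_nonempty
  have h : t * (v ⬝ᵥ u) = t' * (v ⬝ᵥ u) := by
    rw [← smul_eq_mul, ← smul_dotProduct, ← hMv, ← dotProduct_mulVec, hMu, dotProduct_smul,
      smul_eq_mul]
  obtain rfl := mul_right_cancel₀ hvu.ne' h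
  obtain ⟨l, -, hl⟩ := hM.exists_pos_pow
  obtain ⟨r, hr0, hrt, hr⟩ := exists_abs_pow_mulVec_le hl hu hv (pow_mulVec_eigen hMu l)
    (vecMul_pow_eigen hMv l)
  -- Split `x` into `α u` and a vector killed by `v`. Under the powers of `M ^ l` the first part
  -- grows like `(t ^ l) ^ k`, the second at most like `r ^ k`.
  set α := (v ⬝ᵥ x) / (v ⬝ᵥ u) with hα
  have hαpos : 0 < α := div_pos hx hvu
  obtain ⟨s, hs, hbound⟩ := hr (x - α • u) (by
    rw [dotProduct_sub, dotProduct_smul, hα, smul_eq_mul, div_mul_cancel₀ _ hvu.ne', sub_self])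
  have htl : 0 < t ^ l := pow_pos ht' l
  obtain ⟨k, hk⟩ : ∃ k : ℕ, s * (r / t ^ l) ^ k < α := by
    have := (tendsto_pow_atTop_nhds_zero_of_lt_one (div_nonneg hr0 htl.le)
      ((div_lt_one htl).2 hrt)).const_mul s
    rw [mul_zero] at this
    exact (this.eventually_lt_const hαpos).exists
  refine ⟨l * k, fun i => ?_⟩
  have h1 := hbound k i
  rw [mulVec_sub, mulVec_smul, ← pow_mul, pow_mulVec_eigen hMu, pow_mul] at h1
  have h2 := (abs_le.1 h1).1
  simp only [Pi.sub_apply, Pi.smul_apply, smul_eq_mul] at h2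
  have h3 : s * r ^ k < α * (t ^ l) ^ k := by
    rw [div_pow, ← mul_div_assoc, div_lt_iff₀ (pow_pos htl k)] at hk
    exact hk
  have h4 := mul_lt_mul_of_pos_right h3 (hu i)
  rw [← pow_mul] at h4
  rw [← pow_mul (M)] at h2
  linarith

/-- The left eigenspace of the Perron–Frobenius eigenvalue of a primitive matrix is a line. -/
theorem IsPrimitive.exists_eq_smul [Nonempty n] {M : Matrix n n ℝ} (hM : M.IsPrimitive)
    {t : ℝ} {v w : n → ℝ} (hv : ∀ i, 0 < v i) (hMv : v ᵥ* M = t • v) (hMw : w ᵥ* M = t • w) :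
    ∃ c : ℝ, w = c • v := by
  obtain ⟨l, -, hl⟩ := hM.exists_pos_pow
  -- For the minimal ratio `c`, `w - c v` is nonnegative and vanishes at `i₀`; were it nonzero, a
  -- positive power of `M` would make its entry at `i₀` positive.
  obtain ⟨i₀, hi₀⟩ := Finite.exists_min fun i => w i / v i
  refine ⟨w i₀ / v i₀, ?_⟩
  set c := w i₀ / v i₀ with hc
  by_contra hne
  have hpos := mulVec_pos_of_pos (M := (M ^ l)ᵀ) (fun i j => hl j i) (x := w - c • v)
    (fun i => by
      have := hi₀ i
      rw [le_div_iff₀ (hv i)] at this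
      simpa using this) (sub_ne_zero.2 hne) i₀
  rw [mulVec_transpose, sub_vecMul, smul_vecMul, vecMul_pow_eigen hMv, vecMul_pow_eigen hMw] at hpos
  simp only [Pi.sub_apply, Pi.smul_apply, smul_eq_mul] at hpos
  rw [mul_left_comm, hc, div_mul_cancel₀ _ (hv i₀).ne', sub_self] at hpos
  exact lt_irrefl _ hpos

/-- The spectral radius of a nonnegative matrix with a positive left eigenvector is the
eigenvalue. -/
theorem spectralRadius_toReal_eq [Nonempty n] {M : Matrix n n ℝ} (hM : ∀ i j, 0 ≤ M i j)
    {t : ℝ} {v : n → ℝ} (hv : ∀ i, 0 < v i) (hMv : v ᵥ* M = t • v) :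
    (spectralRadius ℂ (M.map (Complex.ofReal : ℝ → ℂ))).toReal = t := by
  have ht : 0 ≤ t := by
    obtain ⟨i⟩ := ‹Nonempty n›
    have h1 := congrFun hMv i
    refine nonneg_of_mul_nonneg_left (b := v i) ?_ (hv i)
    change _ = t * v i at h1
    rw [← h1]
    exact Finset.sum_nonneg fun j _ => mul_nonneg (hv j).le (hM j i)
  -- For an eigenvector `z`, `|μ| |z| ≤ M |z|` entrywise; pairing with the positive row `v` leaves
  -- `|μ| ≤ t`.
  have hle : ∀ μ ∈ spectrum ℂ (M.map (Complex.ofReal : ℝ → ℂ)), ‖μ‖ ≤ t := by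
    intro μ hμ
    rw [← Matrix.spectrum_toLin', ← Module.End.hasEigenvalue_iff_mem_spectrum] at hμ
    obtain ⟨z, hz⟩ := hμ.exists_hasEigenvector
    have hz1 : M.map (Complex.ofReal : ℝ → ℂ) *ᵥ z = μ • z := by
      simpa using hz.apply_eq_smul
    have hent : ∀ i, ‖μ‖ * ‖z i‖ ≤ ∑ j, M i j * ‖z j‖ := fun i => by
      rw [← norm_mul, ← smul_eq_mul, ← Pi.smul_apply, ← hz1]
      refine (norm_sum_le _ _).trans (Finset.sum_le_sum fun j _ => ?_)
      have h1 : ‖(M.map (Complex.ofReal : ℝ → ℂ)) i j‖ = M i j := by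
        rw [map_apply, Complex.norm_real, Real.norm_of_nonneg (hM i j)]
      exact (norm_mul_le _ _).trans_eq (congrArg (· * ‖z j‖) h1)
    have hsum : ‖μ‖ * (v ⬝ᵥ fun i => ‖z i‖) ≤ t * (v ⬝ᵥ fun i => ‖z i‖) := by
      have h1 : t * (v ⬝ᵥ fun i => ‖z i‖) = v ⬝ᵥ (M *ᵥ fun i => ‖z i‖) := by
        rw [dotProduct_mulVec, hMv, smul_dotProduct, smul_eq_mul]
      rw [h1, dotProduct, Finset.mul_sum]
      refine Finset.sum_le_sum fun i _ => ?_
      rw [mul_left_comm]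
      exact mul_le_mul_of_nonneg_left (hent i) (hv i).le
    refine le_of_mul_le_mul_right hsum ?_
    obtain ⟨i, hi⟩ := Function.ne_iff.1 hz.2
    exact Finset.sum_pos' (fun i _ => mul_nonneg (hv i).le (norm_nonneg _))
      ⟨i, Finset.mem_univ i, mul_pos (hv i) (norm_pos_iff.2 hi)⟩
  have hmem : (t : ℂ) ∈ spectrum ℂ (M.map (Complex.ofReal : ℝ → ℂ)) := by
    rw [Matrix.mem_spectrum_iff_isRoot_charpoly]
    have h1 : M.charpoly.IsRoot t := by
      rw [← Matrix.mem_spectrum_iff_isRoot_charpoly, spectrum.mem_iff, Matrix.isUnit_iff_isUnit_det,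
        isUnit_iff_ne_zero, not_not, ← exists_vecMul_eq_zero_iff]
      refine ⟨v, fun h => ?_, ?_⟩
      · obtain ⟨i⟩ := ‹Nonempty n›
        exact (hv i).ne' (congrFun h i)
      · rw [vecMul_sub, hMv, Algebra.algebraMap_eq_smul_one, vecMul_smul, vecMul_one, sub_self]
    have h2 := charpoly_map M Complex.ofRealHom
    change (M.map (Complex.ofReal : ℝ → ℂ)).charpoly = _ at h2
    rw [h2]
    exact h1.map
  have : spectralRadius ℂ (M.map (Complex.ofReal : ℝ → ℂ)) = ENNReal.ofReal t := by
    refine le_antisymm (iSup₂_le fun μ hμ => ?_) ?_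
    · rw [← enorm_eq_nnnorm, ← ofReal_norm]
      exact ENNReal.ofReal_le_ofReal (hle μ hμ)
    · refine le_trans (le_of_eq ?_) (le_iSup₂ (f := fun k _ => (‖k‖₊ : ENNReal)) (t : ℂ) hmem)
      rw [← enorm_eq_nnnorm, ← ofReal_norm, Complex.norm_real, Real.norm_of_nonneg ht]
  rw [this, ENNReal.toReal_ofReal ht]

end PerronFrobenius
end Matrix

/-! ### Eigenvalues of integer matrices. -/

namespace Matrix

variable {N : ℕ}

/-- An eigenvalue of an integer matrix is a root of the characteristic polynomial. -/
lemma aeval_charpoly_eq_zero_of_vecMul {M : Matrix (Fin N) (Fin N) ℤ} {w : Fin N → ℝ} {μ : ℝ}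
    (hw : w ≠ 0) (h : w ᵥ* M.map (Int.cast : ℤ → ℝ) = μ • w) :
    Polynomial.aeval μ M.charpoly = 0 := by
  have h1 : (M.map (Int.cast : ℤ → ℝ)).charpoly.IsRoot μ := by
    rw [← Matrix.mem_spectrum_iff_isRoot_charpoly, spectrum.mem_iff, Matrix.isUnit_iff_isUnit_det,
      isUnit_iff_ne_zero, not_not, ← exists_vecMul_eq_zero_iff]
    refine ⟨w, hw, ?_⟩
    rw [vecMul_sub, h, Algebra.algebraMap_eq_smul_one, vecMul_smul, vecMul_one, sub_self]
  have h2 : (M.map (Int.cast : ℤ → ℝ)).charpoly = _ := charpoly_map M (Int.castRingHom ℝ)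
  rwa [h2, Polynomial.IsRoot, Polynomial.eval_map] at h1

/-- The determinant trick in matrix form; it will show that `λ_B ^ n / λ_A` is an algebraic integer.
-/
lemma isIntegral_of_vecMul {M : Matrix (Fin N) (Fin N) ℤ} {w : Fin N → ℝ} {μ : ℝ}
    (hw : w ≠ 0) (h : w ᵥ* M.map (Int.cast : ℤ → ℝ) = μ • w) : IsIntegral ℤ μ :=
  ⟨M.charpoly, M.charpoly_monic, aeval_charpoly_eq_zero_of_vecMul hw h⟩

lemma map_intCast_pow {R : Type*} [Ring R] (A : Matrix (Fin N) (Fin N) ℤ) (k : ℕ) :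
    (A ^ k).map (Int.cast : ℤ → R) = A.map (Int.cast : ℤ → R) ^ k :=
  A.map_pow (Int.castRingHom R) k

lemma map_intCast_mul {R : Type*} [Ring R] (A B : Matrix (Fin N) (Fin N) ℤ) :
    (A * B).map (Int.cast : ℤ → R) = A.map (Int.cast : ℤ → R) * B.map (Int.cast : ℤ → R) :=
  Matrix.map_mul (f := Int.castRingHom R)

lemma IsPrimitive.map_intCast {A : Matrix (Fin N) (Fin N) ℤ} (hA : A.IsPrimitive) :
    (A.map (Int.cast : ℤ → ℝ)).IsPrimitive := by
  obtain ⟨k, hk0, hk⟩ := hA.exists_pos_pow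
  refine ⟨fun i j => by simpa using hA.nonneg i j, k, hk0, fun i j => ?_⟩
  rw [← map_intCast_pow]
  simpa using hk i j

lemma nonempty_of_irreducible_charpoly {A : Matrix (Fin N) (Fin N) ℤ}
    (hA : Irreducible A.charpoly) : Nonempty (Fin N) := by
  by_contra h
  rw [not_nonempty_iff] at h
  exact hA.not_isUnit (by simp)

end Matrix

open Matrix

/-! ### The Perron root, its field and the ring `ℤ[1/λ]`. -/

variable {N : ℕ} {A B : Matrix (Fin N) (Fin N) ℤ} {v w : Fin N → ℝ} {c : ℝ}

lemma perronRoot_eq [Nonempty (Fin N)] (hA : ∀ i j, 0 ≤ A i j) {v : Fin N → ℝ} {t : ℝ}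
    (hv : ∀ i, 0 < v i) (h : v ᵥ* A.map (Int.cast : ℤ → ℝ) = t • v) : perronRoot A = t := by
  have := spectralRadius_toReal_eq (M := A.map (Int.cast : ℤ → ℝ))
    (fun i j => by simpa using hA i j) hv h
  rw [← this, perronRoot, Matrix.map_map]
  congr 3

lemma Matrix.IsPrimitive.exists_isPerronRow [Nonempty (Fin N)] (hA : A.IsPrimitive) :
    0 < perronRoot A ∧ ∃ v, IsPerronRow A v := by
  obtain ⟨t, ht, -, v, -, hv, -, h⟩ := hA.map_intCast.exists_pos_eigenvectors
  rw [perronRoot_eq hA.nonneg hv h]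
  exact ⟨ht, v, hv, by rw [perronRoot_eq hA.nonneg hv h, h]⟩

lemma Matrix.IsPrimitive.perronRoot_pos (hA : A.IsPrimitive) (hirr : Irreducible A.charpoly) :
    0 < perronRoot A :=
  have := nonempty_of_irreducible_charpoly hirr
  hA.exists_isPerronRow.1

lemma IsPerronRow.ne_zero [h : Nonempty (Fin N)] {v : Fin N → ℝ} (hv : IsPerronRow A v) : v ≠ 0 :=
  h.elim fun i h0 => (hv.pos i).ne' (congrFun h0 i)

lemma aeval_perronRoot_charpoly (hA : A.IsPrimitive) (hirr : Irreducible A.charpoly) :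
    Polynomial.aeval (perronRoot A) A.charpoly = 0 := by
  have := nonempty_of_irreducible_charpoly hirr
  obtain ⟨v, hv⟩ := hA.exists_isPerronRow.2
  exact aeval_charpoly_eq_zero_of_vecMul hv.ne_zero hv.eigen

lemma isIntegral_perronRoot (hA : A.IsPrimitive) (hirr : Irreducible A.charpoly) :
    IsIntegral ℤ (perronRoot A) :=
  ⟨A.charpoly, A.charpoly_monic, aeval_perronRoot_charpoly hA hirr⟩

lemma isIntegral_rat_perronRoot (hA : A.IsPrimitive) (hirr : Irreducible A.charpoly) :
    IsIntegral ℚ (perronRoot A) :=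
  (isIntegral_perronRoot hA hirr).tower_top

/-- By Gauss's lemma the characteristic polynomial stays irreducible over `ℚ`, so it is the minimal
polynomial of `λ`. -/
lemma finrank_perronField (hA : A.IsPrimitive) (hirr : Irreducible A.charpoly) :
    Module.finrank ℚ (perronField A) = N := by
  rw [perronField, IntermediateField.adjoin.finrank (isIntegral_rat_perronRoot hA hirr),
    ← minpoly.eq_of_irreducible_of_monic
      ((A.charpoly_monic.irreducible_iff_irreducible_map_fraction_map (K := ℚ)).1 hirr)
      (by rw [Polynomial.aeval_map_algebraMap, aeval_perronRoot_charpoly hA hirr])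
      (A.charpoly_monic.map _),
    A.charpoly_monic.natDegree_map, charpoly_natDegree_eq_dim, Fintype.card_fin]

lemma perronRoot_mem_perronField (A : Matrix (Fin N) (Fin N) ℤ) : perronRoot A ∈ perronField A :=
  IntermediateField.mem_adjoin_simple_self ℚ _

lemma mem_perronField_iff (hA : A.IsPrimitive) (hirr : Irreducible A.charpoly) {x : ℝ} :
    x ∈ perronField A ↔ x ∈ Algebra.adjoin ℚ {perronRoot A} := by
  rw [perronField, ← IntermediateField.adjoin_simple_toSubalgebra_of_isAlgebraic
    (isIntegral_rat_perronRoot hA hirr).isAlgebraic]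
  rfl

lemma perronRing_le_perronField {x : ℝ} (hx : x ∈ perronRing A) : x ∈ perronField A := by
  have : perronRing A ≤ (perronField A).toSubalgebra.restrictScalars ℤ :=
    Algebra.adjoin_le (by simpa using inv_mem (perronRoot_mem_perronField A))
  exact this hx

lemma inv_perronRoot_mem_perronRing (A : Matrix (Fin N) (Fin N) ℤ) :
    (perronRoot A)⁻¹ ∈ perronRing A :=
  Algebra.self_mem_adjoin_singleton ℤ _

lemma mem_perronRing_iff {x : ℝ} :
    x ∈ perronRing A ↔ ∃ f : Polynomial ℤ, Polynomial.aeval (perronRoot A)⁻¹ f = x := by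
  rw [perronRing, Algebra.adjoin_singleton_eq_range_aeval]
  rfl

/-- The reversed characteristic polynomial vanishes at `1/λ` and has constant term `1`, say `X q +
1`; hence `λ = -q(1/λ)`. -/
lemma perronRoot_mem_perronRing (hA : A.IsPrimitive) (hirr : Irreducible A.charpoly) :
    perronRoot A ∈ perronRing A := by
  have hpos := hA.perronRoot_pos hirr
  let : Invertible (perronRoot A) := invertibleOfNonzero hpos.ne'
  have h1 : Polynomial.aeval (perronRoot A)⁻¹ A.charpoly.reverse = 0 := by
    rw [← invOf_eq_inv]
    exact (Polynomial.eval₂_reverse_eq_zero_iff _ _ _).2 (aeval_perronRoot_charpoly hA hirr)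
  rw [← Polynomial.divX_mul_X_add A.charpoly.reverse, Polynomial.coeff_zero_reverse,
    A.charpoly_monic.leadingCoeff] at h1
  simp only [map_add, map_mul, Polynomial.aeval_X, map_one] at h1
  rw [mem_perronRing_iff]
  refine ⟨-A.charpoly.reverse.divX, ?_⟩
  rw [map_neg]
  have h2 := congrArg (perronRoot A * ·) h1
  simp only [mul_add, mul_zero, mul_one] at h2
  rw [mul_comm (Polynomial.aeval _ _), mul_inv_cancel_left₀ hpos.ne'] at h2
  linarith

lemma exists_mul_mem_perronRing (hA : A.IsPrimitive) (hirr : Irreducible A.charpoly) {x : ℝ}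
    (hx : x ∈ perronField A) : ∃ m : ℤ, 0 < m ∧ (m : ℝ) * x ∈ perronRing A := by
  rw [mem_perronField_iff hA hirr] at hx
  induction hx using Algebra.adjoin_induction with
  | mem x hx =>
    obtain rfl := hx
    exact ⟨1, one_pos, by simpa using perronRoot_mem_perronRing hA hirr⟩
  | algebraMap q =>
    refine ⟨q.den, by exact_mod_cast q.pos, ?_⟩
    have : ((q.den : ℤ) : ℝ) * algebraMap ℚ ℝ q = (q.num : ℝ) := by
      rw [eq_ratCast]
      exact_mod_cast Rat.den_mul_eq_num q
    rw [this]
    exact intCast_mem _ _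
  | add x y _ _ hx hy =>
    obtain ⟨m, hm, hmx⟩ := hx
    obtain ⟨k, hk, hky⟩ := hy
    refine ⟨m * k, mul_pos hm hk, ?_⟩
    have : ((m * k : ℤ) : ℝ) * (x + y) = k * (m * x) + m * (k * y) := by push_cast; ring
    rw [this]
    exact add_mem (mul_mem (intCast_mem _ _) hmx) (mul_mem (intCast_mem _ _) hky)
  | mul x y _ _ hx hy =>
    obtain ⟨m, hm, hmx⟩ := hx
    obtain ⟨k, hk, hky⟩ := hy
    refine ⟨m * k, mul_pos hm hk, ?_⟩
    have : ((m * k : ℤ) : ℝ) * (x * y) = (m * x) * (k * y) := by push_cast; ring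
    rw [this]
    exact mul_mem hmx hky

lemma IsPerronRow.exists_eq_smul (hA : A.IsPrimitive) {v w : Fin N → ℝ} (hv : IsPerronRow A v)
    (hw : w ᵥ* A.map (Int.cast : ℤ → ℝ) = perronRoot A • w) : ∃ c : ℝ, w = c • v := by
  rcases isEmpty_or_nonempty (Fin N)
  · exact ⟨0, Subsingleton.elim _ _⟩
  · exact hA.map_intCast.exists_eq_smul hv.pos hv.eigen hw

/-- There is a left Perron–Frobenius eigenvector with components in `ℤ[1/λ]`. -/
lemma exists_isPerronRow_mem_perronRing (hA : A.IsPrimitive) (hirr : Irreducible A.charpoly) :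
    ∃ v, IsPerronRow A v ∧ ∀ i, v i ∈ perronRing A := by
  have hne := nonempty_of_irreducible_charpoly hirr
  obtain ⟨u, hu⟩ := hA.exists_isPerronRow.2
  set l : perronRing A := ⟨perronRoot A, perronRoot_mem_perronRing hA hirr⟩
  -- `A - λ` is singular over `ℝ`, hence over the domain `ℤ[1/λ]`, so it has a nonzero kernel row
  -- there. That row is a real multiple of a positive one; only the sign needs correction.
  have hdet : (A.map (Int.cast : ℤ → perronRing A) - l • (1 : Matrix (Fin N) (Fin N) _)).det = 0 := by
    have hinj : Function.Injective (perronRing A).val := Subtype.val_injective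
    apply hinj
    rw [map_zero, AlgHom.map_det, ← exists_vecMul_eq_zero_iff]
    refine ⟨u, hu.ne_zero, ?_⟩
    have : (perronRing A).val.mapMatrix
        (A.map (Int.cast : ℤ → perronRing A) - l • (1 : Matrix (Fin N) (Fin N) _)) =
        A.map (Int.cast : ℤ → ℝ) - perronRoot A • (1 : Matrix (Fin N) (Fin N) ℝ) := by
      ext i j
      rcases eq_or_ne i j with rfl | hij
      · simp [l]
      · simp [hij]
    rw [this, vecMul_sub, hu.eigen, vecMul_smul, vecMul_one, sub_self]
  obtain ⟨w, hw0, hw⟩ := exists_vecMul_eq_zero_iff.2 hdet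
  have hw' : (fun i => (w i : ℝ)) ᵥ* A.map (Int.cast : ℤ → ℝ) =
      perronRoot A • fun i => (w i : ℝ) := by
    rw [vecMul_sub, vecMul_smul, vecMul_one, sub_eq_zero] at hw
    ext j
    have := congrArg (Subtype.val) (congrFun hw j)
    simpa [vecMul, dotProduct, l] using this
  obtain ⟨c, hc⟩ := hu.exists_eq_smul hA hw'
  have hc' : ∀ i, (w i : ℝ) = c * u i := fun i => congrFun hc i
  rcases lt_trichotomy c 0 with h | rfl | h
  · refine ⟨fun i => -(w i : ℝ), ⟨fun i => ?_, ?_⟩, fun i => neg_mem (w i).2⟩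
    · rw [hc']
      nlinarith [mul_pos_of_neg_of_neg h (neg_neg_of_pos (hu.pos i))]
    · change (-(fun i => (w i : ℝ))) ᵥ* _ = _ • (-(fun i => (w i : ℝ)))
      rw [neg_vecMul, hw', smul_neg]
  · refine absurd (funext fun i => ?_) hw0
    ext
    simp [hc' i]
  · exact ⟨fun i => w i, ⟨fun i => by rw [hc']; exact mul_pos h (hu.pos i), hw'⟩, fun i => (w i).2⟩

/-! ### The trace as an isomorphism from `ℚᴺ` to `ℚ[λ]`. -/

lemma tracePairing_apply (v : Fin N → ℝ) (g : Fin N → ℚ) :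
    tracePairing v g = v ⬝ᵥ fun i => (g i : ℝ) := rfl

lemma tracePairing_intCast (v : Fin N → ℝ) (z : Fin N → ℤ) :
    tracePairing v (fun i => (z i : ℚ)) = v ⬝ᵥ fun i => (z i : ℝ) := by
  simp [tracePairing_apply]

lemma tracePairing_smul (v : Fin N → ℝ) (q : ℚ) (g : Fin N → ℚ) :
    tracePairing v (q • g) = q * tracePairing v g := by
  simp only [tracePairing_apply, dotProduct, Finset.mul_sum, Pi.smul_apply, smul_eq_mul]
  exact Finset.sum_congr rfl fun i _ => by push_cast; ring

lemma tracePairing_single (v : Fin N → ℝ) (i : Fin N) :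
    tracePairing v (Pi.single i 1) = v i := by
  have : (fun j => ((Pi.single i 1 : Fin N → ℚ) j : ℝ)) = Pi.single i 1 := by
    ext j
    rcases eq_or_ne j i with rfl | h
    · simp
    · simp [h]
  rw [tracePairing_apply, this, dotProduct_single_one]

lemma ratMat_mulVec_intCast (M : Matrix (Fin N) (Fin N) ℤ) (z : Fin N → ℤ) :
    ratMat M *ᵥ (fun i => (z i : ℚ)) = fun i => ((M *ᵥ z) i : ℚ) := by
  ext i
  simp [ratMat, mulVec, dotProduct]

lemma ratMat_pow (M : Matrix (Fin N) (Fin N) ℤ) (k : ℕ) : ratMat (M ^ k) = ratMat M ^ k :=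
  map_intCast_pow M k

lemma ratMat_mul (M M' : Matrix (Fin N) (Fin N) ℤ) : ratMat (M * M') = ratMat M * ratMat M' :=
  map_intCast_mul M M'

lemma tracePairing_ratMat_mulVec (v : Fin N → ℝ) (M : Matrix (Fin N) (Fin N) ℤ) (g : Fin N → ℚ) :
    tracePairing v (ratMat M *ᵥ g) = tracePairing (v ᵥ* M.map (Int.cast : ℤ → ℝ)) g := by
  have : (fun i => ((ratMat M *ᵥ g) i : ℝ)) = M.map (Int.cast : ℤ → ℝ) *ᵥ fun i => (g i : ℝ) := by
    ext i
    simp [ratMat, mulVec, dotProduct]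
  rw [tracePairing_apply, this, dotProduct_mulVec, tracePairing_apply]

lemma tracePairing_smul_left (c : ℝ) (v : Fin N → ℝ) (g : Fin N → ℚ) :
    tracePairing (c • v) g = c * tracePairing v g := by
  rw [tracePairing_apply, smul_dotProduct, smul_eq_mul, tracePairing_apply]

namespace IsPerronRow

lemma tracePairing_mulVec (hv : IsPerronRow A v) (g : Fin N → ℚ) :
    tracePairing v (ratMat A *ᵥ g) = perronRoot A * tracePairing v g := by
  rw [tracePairing_ratMat_mulVec, hv.eigen, tracePairing_smul_left]

lemma tracePairing_pow_mulVec (hv : IsPerronRow A v) (k : ℕ) (g : Fin N → ℚ) :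
    tracePairing v (ratMat A ^ k *ᵥ g) = perronRoot A ^ k * tracePairing v g := by
  induction k with
  | zero => simp
  | succ k ih => rw [pow_succ', ← mulVec_mulVec, hv.tracePairing_mulVec, ih]; ring

lemma tracePairing_aeval_mulVec (hv : IsPerronRow A v) (f : Polynomial ℚ) (g : Fin N → ℚ) :
    tracePairing v (Polynomial.aeval (ratMat A) f *ᵥ g) =
      Polynomial.aeval (perronRoot A) f * tracePairing v g := by
  induction f using Polynomial.induction_on' with
  | add p q hp hq => rw [map_add, add_mulVec, map_add, hp, hq, map_add, add_mul]
  | monomial n a =>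
    rw [Polynomial.aeval_monomial, Polynomial.aeval_monomial, ← Algebra.smul_def, smul_mulVec,
      tracePairing_smul, hv.tracePairing_pow_mulVec, eq_ratCast]
    ring

lemma tracePairing_mem_perronField (hvK : ∀ i, v i ∈ perronField A) (g : Fin N → ℚ) :
    tracePairing v g ∈ perronField A :=
  (sum_mem fun i _ => mul_mem (hvK i) (SubfieldClass.ratCast_mem _ (g i)) :
    ∑ i, v i * (g i : ℝ) ∈ perronField A)

/-- The trace maps `ℚᴺ` onto `ℚ[λ]`. -/
lemma exists_tracePairing_eq (hA : A.IsPrimitive) (hirr : Irreducible A.charpoly)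
    (hv : IsPerronRow A v) (hvK : ∀ i, v i ∈ perronField A) {x : ℝ} (hx : x ∈ perronField A) :
    ∃ g, tracePairing v g = x := by
  obtain ⟨i⟩ := nonempty_of_irreducible_charpoly hirr
  have h1 : x / v i ∈ Algebra.adjoin ℚ {perronRoot A} :=
    (mem_perronField_iff hA hirr).1 (div_mem hx (hvK i))
  rw [Algebra.adjoin_singleton_eq_range_aeval] at h1
  obtain ⟨f, hf⟩ := h1
  -- Since `x / v i = f(λ)`, the vector `f(A) eᵢ` has trace `f(λ) v i = x`.
  refine ⟨Polynomial.aeval (ratMat A) f *ᵥ Pi.single i 1, ?_⟩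
  rw [hv.tracePairing_aeval_mulVec, tracePairing_single]
  exact (congrArg (· * v i) hf).trans (div_mul_cancel₀ _ (hv.pos i).ne')

/-- The trace is injective on `ℚᴺ`. -/
lemma tracePairing_injective (hA : A.IsPrimitive) (hirr : Irreducible A.charpoly)
    (hv : IsPerronRow A v) (hvK : ∀ i, v i ∈ perronField A) :
    Function.Injective (tracePairing v) := by
  let T : (Fin N → ℚ) →ₗ[ℚ] perronField A :=
    { toFun := fun g => ⟨tracePairing v g, tracePairing_mem_perronField hvK g⟩
      map_add' := fun a b => Subtype.ext (map_add _ a b)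
      map_smul' := fun q a => Subtype.ext <| by
        refine (tracePairing_smul v q a).trans ?_
        rw [RingHom.id_apply, Algebra.smul_def]
        rfl }
  have hsurj : Function.Surjective T := fun x => by
    obtain ⟨g, hg⟩ := exists_tracePairing_eq hA hirr hv hvK x.2
    exact ⟨g, Subtype.ext hg⟩
  have : FiniteDimensional ℚ (perronField A) := by
    have := nonempty_of_irreducible_charpoly hirr
    exact Module.finite_of_finrank_pos (by
      rw [finrank_perronField hA hirr]
      exact Fin.pos_iff_nonempty.2 this)
  have hinj : Function.Injective T :=
    (LinearMap.injective_iff_surjective_of_finrank_eq_finrank (by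
      rw [finrank_perronField hA hirr, Module.finrank_fin_fun])).2 hsurj
  exact fun a b h => hinj (Subtype.ext h)

/-- An integer matrix is determined by its action on a left Perron–Frobenius eigenvector. -/
lemma matrix_ext (hA : A.IsPrimitive) (hirr : Irreducible A.charpoly)
    (hv : IsPerronRow A v) (hvK : ∀ i, v i ∈ perronField A) {M M' : Matrix (Fin N) (Fin N) ℤ}
    (h : v ᵥ* M.map (Int.cast : ℤ → ℝ) = v ᵥ* M'.map (Int.cast : ℤ → ℝ)) : M = M' := by
  ext i j
  have h1 : ratMat M *ᵥ Pi.single j 1 = ratMat M' *ᵥ Pi.single j 1 :=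
    tracePairing_injective hA hirr hv hvK (by
      rw [tracePairing_ratMat_mulVec, tracePairing_ratMat_mulVec, h])
  have h2 := congrFun h1 i
  simpa [ratMat] using h2

end IsPerronRow

/-- Under the injective trace, `A` becomes multiplication by `λ ≠ 0`. -/
lemma isUnit_det_ratMat (hA : A.IsPrimitive) (hirr : Irreducible A.charpoly) :
    IsUnit (ratMat A).det := by
  obtain ⟨v, hv, hvR⟩ := exists_isPerronRow_mem_perronRing hA hirr
  rw [← Matrix.isUnit_iff_isUnit_det, ← mulVec_injective_iff_isUnit]
  intro a b hab
  refine hv.tracePairing_injective hA hirr (fun i => perronRing_le_perronField (hvR i)) ?_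
  have := congrArg (tracePairing v) hab
  simp only [hv.tracePairing_mulVec] at this
  exact mul_left_cancel₀ (hA.perronRoot_pos hirr).ne' this

lemma isUnit_ratMat_pow (hA : A.IsPrimitive) (hirr : Irreducible A.charpoly) (k : ℕ) :
    IsUnit (ratMat A ^ k).det := by
  rw [det_pow]
  exact (isUnit_det_ratMat hA hirr).pow k

/-! ### The dimension group, its cone and its trace range. -/

lemma mem_dimGroup_iff {g : Fin N → ℚ} :
    g ∈ dimGroup A ↔ ∃ (n : ℕ) (z : Fin N → ℤ), ratMat A ^ n *ᵥ g = fun i => (z i : ℚ) :=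
  Iff.rfl

lemma intCast_mem_dimGroup (A : Matrix (Fin N) (Fin N) ℤ) (z : Fin N → ℤ) :
    (fun i => (z i : ℚ)) ∈ dimGroup A :=
  ⟨0, z, by simp⟩

namespace IsPerronRow

lemma tracePairing_invEnd (hA : A.IsPrimitive) (hirr : Irreducible A.charpoly)
    (hv : IsPerronRow A v) (g : dimGroup A) :
    tracePairing v (invEnd A g : Fin N → ℚ) = (perronRoot A)⁻¹ * tracePairing v g := by
  rw [eq_inv_mul_iff_mul_eq₀ (hA.perronRoot_pos hirr).ne', ← hv.tracePairing_mulVec]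
  change tracePairing v (ratMat A *ᵥ ((ratMat A)⁻¹ *ᵥ (g : Fin N → ℚ))) = _
  rw [mulVec_mulVec, mul_nonsing_inv _ (isUnit_det_ratMat hA hirr), one_mulVec]

lemma tracePairing_aeval_invEnd (hA : A.IsPrimitive) (hirr : Irreducible A.charpoly)
    (hv : IsPerronRow A v) (f : Polynomial ℤ) (g : dimGroup A) :
    tracePairing v (Polynomial.aeval (invEnd A) f g : dimGroup A) =
      Polynomial.aeval (perronRoot A)⁻¹ f * tracePairing v g := by
  have hpow : ∀ (k : ℕ), tracePairing v ((invEnd A ^ k) g : dimGroup A) =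
      (perronRoot A)⁻¹ ^ k * tracePairing v g := by
    intro k
    induction k with
    | zero => simp
    | succ k ih =>
      rw [pow_succ', Module.End.mul_apply, hv.tracePairing_invEnd hA hirr, ih]
      ring
  induction f using Polynomial.induction_on' with
  | add p q hp hq =>
    rw [map_add, LinearMap.add_apply, Submodule.coe_add, map_add, hp, hq, map_add, add_mul]
  | monomial n a =>
    rw [Polynomial.aeval_monomial, Polynomial.aeval_monomial, ← Algebra.smul_def,
      LinearMap.smul_apply, Submodule.coe_smul, map_smul, hpow, zsmul_eq_mul, eq_intCast, mul_assoc]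

/-- The positive cone of the dimension group is where the trace is nonnegative. -/
lemma dimNonneg_iff (hA : A.IsPrimitive) (hirr : Irreducible A.charpoly)
    (hv : IsPerronRow A v) (hvK : ∀ i, v i ∈ perronField A) (g : dimGroup A) :
    DimNonneg A g ↔ 0 ≤ tracePairing v g := by
  have hpos := hA.perronRoot_pos hirr
  constructor
  · rintro ⟨n, z, hz, h⟩
    have h1 := hv.tracePairing_pow_mulVec n g
    rw [h, tracePairing_intCast] at h1
    refine nonneg_of_mul_nonneg_right (a := perronRoot A ^ n) ?_ (pow_pos hpos n)
    rw [← h1]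
    exact Finset.sum_nonneg fun i _ => mul_nonneg (hv.pos i).le (Int.cast_nonneg (hz i))
  · intro h
    -- Trace zero forces `g = 0`. If the trace is positive, so is that of the integer vector `A ^ n
    -- g`, and a further power of `A` makes its entries positive.
    rcases h.eq_or_lt with h0 | h0
    · have : (g : Fin N → ℚ) = 0 :=
        hv.tracePairing_injective hA hirr hvK (by rw [← h0, map_zero])
      exact ⟨0, 0, fun _ => le_rfl, by ext; simp [this]⟩
    · obtain ⟨n, z, hz⟩ := mem_dimGroup_iff.1 g.2
      have h1 := hv.tracePairing_pow_mulVec n g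
      rw [hz, tracePairing_intCast] at h1
      have := nonempty_of_irreducible_charpoly hirr
      obtain ⟨k, hk⟩ := hA.map_intCast.exists_pow_mulVec_pos hv.pos hv.eigen
        (x := fun i => (z i : ℝ)) (by rw [h1]; positivity)
      refine ⟨k + n, A ^ k *ᵥ z, fun i => ?_, ?_⟩
      · have h2 := hk i
        rw [← map_intCast_pow] at h2
        have h3 : ((A ^ k).map (Int.cast : ℤ → ℝ) *ᵥ fun i => (z i : ℝ)) i =
            ((A ^ k *ᵥ z) i : ℤ) := by simp [mulVec, dotProduct]
        rw [h3] at h2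
        exact_mod_cast h2.le
      · rw [pow_add, ← mulVec_mulVec, hz, ← ratMat_pow, ratMat_mulVec_intCast]

end IsPerronRow

lemma mem_traceRange_iff {x : ℝ} :
    x ∈ traceRange A v ↔ ∃ g : dimGroup A, tracePairing v g = x := by
  constructor
  · rintro ⟨g, hg, rfl⟩
    exact ⟨⟨g, hg⟩, rfl⟩
  · rintro ⟨g, rfl⟩
    exact ⟨g, g.2, rfl⟩

lemma apply_mem_traceRange (A : Matrix (Fin N) (Fin N) ℤ) (v : Fin N → ℝ) (i : Fin N) :
    v i ∈ traceRange A v := by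
  refine mem_traceRange_iff.2 ⟨⟨_, intCast_mem_dimGroup A (Pi.single i 1)⟩, ?_⟩
  rw [← tracePairing_single v i]
  congr 1
  ext j
  rcases eq_or_ne j i with rfl | hj
  · simp
  · simp [hj]

/-- The trace as an isomorphism of the dimension group onto its range. -/
noncomputable def traceEquiv (hA : A.IsPrimitive) (hirr : Irreducible A.charpoly)
    (hv : IsPerronRow A v) (hvK : ∀ i, v i ∈ perronField A) : dimGroup A ≃+ traceRange A v :=
  AddEquiv.ofBijective
    (AddMonoidHom.mk' (fun g : dimGroup A => (⟨tracePairing v g, mem_traceRange_iff.2 ⟨g, rfl⟩⟩ : traceRange A v))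
      (fun a b => Subtype.ext (map_add (tracePairing v) (a : Fin N → ℚ) b)))
    ⟨fun _ _ h => Subtype.ext (hv.tracePairing_injective hA hirr hvK (congrArg Subtype.val h)),
      fun x => (mem_traceRange_iff.1 x.2).imp fun _ h => Subtype.ext h⟩

lemma coe_traceEquiv (hA : A.IsPrimitive) (hirr : Irreducible A.charpoly)
    (hv : IsPerronRow A v) (hvK : ∀ i, v i ∈ perronField A) (g : dimGroup A) :
    (traceEquiv hA hirr hv hvK g : ℝ) = tracePairing v g := rfl

lemma mul_mem_traceRange (hA : A.IsPrimitive) (hirr : Irreducible A.charpoly)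
    (hv : IsPerronRow A v) {r x : ℝ} (hr : r ∈ perronRing A) (hx : x ∈ traceRange A v) :
    r * x ∈ traceRange A v := by
  obtain ⟨f, rfl⟩ := mem_perronRing_iff.1 hr
  obtain ⟨g, rfl⟩ := mem_traceRange_iff.1 hx
  exact mem_traceRange_iff.2 ⟨_, hv.tracePairing_aeval_invEnd hA hirr f g⟩

lemma exists_pow_mul_eq_intCast (hv : IsPerronRow A v) {x : ℝ} (hx : x ∈ traceRange A v) :
    ∃ (n : ℕ) (z : Fin N → ℤ), perronRoot A ^ n * x = v ⬝ᵥ fun i => (z i : ℝ) := by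
  obtain ⟨g, rfl⟩ := mem_traceRange_iff.1 hx
  obtain ⟨n, z, hz⟩ := mem_dimGroup_iff.1 g.2
  exact ⟨n, z, by rw [← hv.tracePairing_pow_mulVec, hz, tracePairing_intCast]⟩

/-- Up to a power of the ring element `1/λ`, `x` is an integer combination of the `v i`. A common
denominator `m` of `v` makes the range a fractional ideal; `m = 1` gives the integral case. -/
lemma mul_mem_perronRing_of_mem_traceRange (hA : A.IsPrimitive) (hirr : Irreducible A.charpoly)
    (hv : IsPerronRow A v) {m : ℝ} (hm : ∀ i, m * v i ∈ perronRing A) {x : ℝ}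
    (hx : x ∈ traceRange A v) : m * x ∈ perronRing A := by
  obtain ⟨n, z, hz⟩ := exists_pow_mul_eq_intCast hv hx
  have h1 : m * x = (perronRoot A)⁻¹ ^ n * ∑ i, m * v i * (z i : ℝ) := by
    rw [inv_pow, eq_inv_mul_iff_mul_eq₀ (pow_pos (hA.perronRoot_pos hirr) n).ne', mul_left_comm, hz,
      dotProduct, Finset.mul_sum]
    exact Finset.sum_congr rfl fun i _ => by ring
  rw [h1]
  exact mul_mem (pow_mem (inv_perronRoot_mem_perronRing A) n)
    (sum_mem fun i _ => mul_mem (hm i) (intCast_mem _ _))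

lemma exists_forall_mul_mem_perronRing (hA : A.IsPrimitive) (hirr : Irreducible A.charpoly)
    {ι : Type*} [Fintype ι] {x : ι → ℝ} (hx : ∀ i, x i ∈ perronField A) :
    ∃ m : ℤ, 0 < m ∧ ∀ i, (m : ℝ) * x i ∈ perronRing A := by
  classical
  choose m hm hmx using fun i => exists_mul_mem_perronRing hA hirr (hx i)
  refine ⟨∏ i, m i, Finset.prod_pos fun i _ => hm i, fun i => ?_⟩
  rw [← Finset.prod_erase_mul _ _ (Finset.mem_univ i), Int.cast_mul, mul_assoc]
  exact mul_mem (intCast_mem _ _) (hmx i)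

/-- The trace identifies the dimension group with a fractional ideal of `ℤ[1/λ]`. -/
theorem IsPerronRow.traceIsModuleIso (hA : A.IsPrimitive) (hirr : Irreducible A.charpoly)
    (hv : IsPerronRow A v) (hvK : ∀ i, v i ∈ perronField A) : TraceIsModuleIso A v := by
  let I : Submodule (perronRing A) ℝ :=
    { traceRange A v with
      smul_mem' := fun r _ hx => mul_mem_traceRange hA hirr hv r.2 hx }
  have hI : ∀ x, x ∈ I ↔ x ∈ traceRange A v := fun _ => Iff.rfl
  obtain ⟨m, hm, hmv⟩ := exists_forall_mul_mem_perronRing hA hirr hvK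
  have hfrac : IsFractional (nonZeroDivisors (perronRing A)) I := by
    refine ⟨(m : perronRing A), mem_nonZeroDivisors_of_ne_zero (by exact_mod_cast hm.ne'),
      fun x hx => ?_⟩
    exact ⟨⟨m * x, mul_mem_perronRing_of_mem_traceRange hA hirr hv hmv hx⟩, rfl⟩
  refine ⟨⟨I, hfrac⟩, traceEquiv hA hirr hv hvK, fun x => Iff.rfl, fun hvR x hx => ?_,
    fun g => rfl, fun f g => hv.tracePairing_aeval_invEnd hA hirr f g⟩
  have h1 := mul_mem_perronRing_of_mem_traceRange hA hirr hv (m := 1) (by simpa using hvR) hx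
  rw [one_mul] at h1
  exact (FractionalIdeal.mem_one_iff _).2 ⟨⟨x, h1⟩, rfl⟩

/-! ### Order isomorphisms and proportional traces. -/

/-- Two homomorphisms to `ℝ` that induce the same order are proportional. -/
lemma AddMonoidHom.exists_pos_eq_mul {G : Type*} [AddCommGroup G] (s t : G →+ ℝ)
    (h : ∀ g, 0 ≤ s g ↔ 0 ≤ t g) : ∃ c : ℝ, 0 < c ∧ ∀ g, t g = c * s g := by
  have hlt : ∀ g, s g < 0 ↔ t g < 0 := fun g => by rw [← not_le, ← not_le, h]
  have hgt : ∀ g, 0 < s g ↔ 0 < t g := fun g => by simpa using hlt (-g)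
  by_cases hs : ∀ g, s g = 0
  · refine ⟨1, one_pos, fun g => ?_⟩
    have h1 := (h g).1 (hs g).ge
    have h2 := (h (-g)).1 (hs (-g)).ge
    rw [map_neg] at h2
    rw [hs, mul_zero]
    linarith
  · obtain ⟨x, hx⟩ : ∃ x, 0 < s x := by
      push Not at hs
      obtain ⟨g, hg⟩ := hs
      rcases hg.lt_or_gt with h1 | h1
      · exact ⟨-g, by simpa using h1⟩
      · exact ⟨g, h1⟩
    have htx := (hgt x).1 hx
    -- A rational `p/q` strictly between the two ratios would make `q y - p x` positive under `s`
    -- and negative under `t`. The reverse inequality comes from `-y`.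
    have key : ∀ y, s y / s x ≤ t y / t x := by
      intro y
      by_contra! hcon
      obtain ⟨q, hq1, hq2⟩ := exists_rat_btwn hcon
      have hd : (0 : ℝ) < q.den := by exact_mod_cast q.pos
      rw [Rat.cast_def, div_lt_div_iff₀ htx hd] at hq1
      rw [Rat.cast_def, div_lt_div_iff₀ hd hx] at hq2
      have h1 : 0 < s ((q.den : ℤ) • y - q.num • x) := by
        simp only [map_sub, map_zsmul, zsmul_eq_mul, Int.cast_natCast]
        linarith
      rw [hgt] at h1
      simp only [map_sub, map_zsmul, zsmul_eq_mul, Int.cast_natCast] at h1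
      linarith
    refine ⟨t x / s x, div_pos htx hx, fun y => ?_⟩
    have h1 := key y
    have h2 := key (-y)
    rw [map_neg, map_neg, neg_div, neg_div, neg_le_neg_iff] at h2
    have h3 := le_antisymm h2 h1
    field_simp at h3 ⊢
    linarith

/-- The dimension groups of `A` and `B` are isomorphic in such a way that the traces given by `v`
and `w` differ by the factor `c`. -/
def TraceScaled (A B : Matrix (Fin N) (Fin N) ℤ) (v w : Fin N → ℝ) (c : ℝ) : Prop :=
  ∃ φ : dimGroup A ≃+ dimGroup B, ∀ g : dimGroup A,
    tracePairing w (φ g : Fin N → ℚ) = c * tracePairing v (g : Fin N → ℚ)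

namespace TraceScaled

lemma symm (hc : c ≠ 0) (h : TraceScaled A B v w c) : TraceScaled B A w v c⁻¹ := by
  obtain ⟨φ, hφ⟩ := h
  refine ⟨φ.symm, fun g => ?_⟩
  rw [eq_inv_mul_iff_mul_eq₀ hc, ← hφ, φ.apply_symm_apply]

/-- Composition with `-1` flips the sign of the factor, so any nonzero factor can be made positive.
-/
lemma neg (h : TraceScaled A B v w c) : TraceScaled A B v w (-c) := by
  obtain ⟨φ, hφ⟩ := h
  refine ⟨φ.trans (AddEquiv.neg _), fun g => ?_⟩
  change tracePairing w (-(φ g : Fin N → ℚ)) = _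
  rw [map_neg, hφ, neg_mul]

lemma exists_pos (hc : c ≠ 0) (h : TraceScaled A B v w c) :
    ∃ c' : ℝ, 0 < c' ∧ TraceScaled A B v w c' := by
  rcases hc.lt_or_gt with h0 | h0
  · exact ⟨-c, neg_pos.2 h0, h.neg⟩
  · exact ⟨c, h0, h⟩

lemma mul_mem (h : TraceScaled A B v w c) {x : ℝ} (hx : x ∈ traceRange A v) :
    c * x ∈ traceRange B w := by
  obtain ⟨φ, hφ⟩ := h
  obtain ⟨g, rfl⟩ := mem_traceRange_iff.1 hx
  exact mem_traceRange_iff.2 ⟨φ g, hφ g⟩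

end TraceScaled

/-- The trace as a homomorphism from the dimension group to `ℝ`. -/
noncomputable def dimTrace (A : Matrix (Fin N) (Fin N) ℤ) (v : Fin N → ℝ) : dimGroup A →+ ℝ :=
  ((tracePairing v).comp (dimGroup A).subtype).toAddMonoidHom

theorem orderedDimIso_iff_traceScaled (hA : A.IsPrimitive) (hAirr : Irreducible A.charpoly)
    (hB : B.IsPrimitive) (hBirr : Irreducible B.charpoly) (hv : IsPerronRow A v)
    (hvK : ∀ i, v i ∈ perronField A) (hw : IsPerronRow B w) (hwK : ∀ i, w i ∈ perronField B) :
    OrderedDimIso A B ↔ ∃ c : ℝ, 0 < c ∧ TraceScaled A B v w c := by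
  constructor
  · rintro ⟨φ, hφ⟩
    obtain ⟨c, hc, h⟩ := AddMonoidHom.exists_pos_eq_mul (dimTrace A v)
      ((dimTrace B w).comp φ.toAddMonoidHom) (fun g => by
        have := hφ g
        rwa [hv.dimNonneg_iff hA hAirr hvK, hw.dimNonneg_iff hB hBirr hwK] at this)
    exact ⟨c, hc, φ, h⟩
  · rintro ⟨c, hc, φ, h⟩
    refine ⟨φ, fun g => ?_⟩
    rw [hv.dimNonneg_iff hA hAirr hvK, hw.dimNonneg_iff hB hBirr hwK, h,
      mul_nonneg_iff_of_pos_left hc]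

/-- An order isomorphism and the inclusion of the range induce the same order, hence are
proportional; conversely multiplication by `c` is an order isomorphism. -/
theorem nonempty_traceRange_orderIso_iff (hA : A.IsPrimitive) (hAirr : Irreducible A.charpoly)
    (hB : B.IsPrimitive) (hBirr : Irreducible B.charpoly) (hv : IsPerronRow A v)
    (hvK : ∀ i, v i ∈ perronField A) (hw : IsPerronRow B w) (hwK : ∀ i, w i ∈ perronField B) :
    Nonempty (traceRange A v ≃+o traceRange B w) ↔ ∃ c : ℝ, 0 < c ∧ TraceScaled A B v w c := by
  constructor
  · rintro ⟨e⟩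
    obtain ⟨c, hc, h⟩ := AddMonoidHom.exists_pos_eq_mul (traceRange A v).subtype
      ((traceRange B w).subtype.comp (e : traceRange A v ≃+ traceRange B w).toAddMonoidHom)
      (fun g => by
        have h1 : (0 : traceRange A v) ≤ g ↔ e 0 ≤ e g := (map_le_map_iff e).symm
        rw [map_zero] at h1
        exact h1)
    refine ⟨c, hc, ((traceEquiv hA hAirr hv hvK).trans (e : traceRange A v ≃+ traceRange B w)).trans
      (traceEquiv hB hBirr hw hwK).symm, fun g => ?_⟩
    rw [← coe_traceEquiv hB hBirr hw hwK, AddEquiv.trans_apply, AddEquiv.apply_symm_apply]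
    exact h (traceEquiv hA hAirr hv hvK g)
  · rintro ⟨c, hc, h⟩
    have h' := h.symm hc.ne'
    refine ⟨⟨⟨⟨fun x => ⟨c * x, h.mul_mem x.2⟩, fun x => ⟨c⁻¹ * x, h'.mul_mem x.2⟩, fun x => ?_,
      fun x => ?_⟩, fun x y => ?_⟩, fun {x y} => ?_⟩⟩
    · exact Subtype.ext (inv_mul_cancel_left₀ hc.ne' _)
    · exact Subtype.ext (mul_inv_cancel_left₀ hc.ne' _)
    · exact Subtype.ext (mul_add c _ _)
    · exact mul_le_mul_iff_right₀ hc

/-! ### From `C*`-equivalence to the dimension groups -/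

lemma NonnegEntries.mulVec_nonneg {M : Matrix (Fin N) (Fin N) ℤ} (hM : NonnegEntries M)
    {z : Fin N → ℤ} (hz : ∀ i, 0 ≤ z i) (i : Fin N) : 0 ≤ (M *ᵥ z) i :=
  (Finset.sum_nonneg fun j _ => mul_nonneg (hM i j) (hz j) : 0 ≤ ∑ j, M i j * z j)

lemma NonnegEntries.mul {M M' : Matrix (Fin N) (Fin N) ℤ} (hM : NonnegEntries M)
    (hM' : NonnegEntries M') : NonnegEntries (M * M') :=
  fun i j => by
    rw [Matrix.mul_apply]
    exact Finset.sum_nonneg fun l _ => mul_nonneg (hM i l) (hM' l j)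

lemma NonnegEntries.pow {M : Matrix (Fin N) (Fin N) ℤ} (hM : NonnegEntries M) (k : ℕ) :
    NonnegEntries (M ^ k) :=
  fun i j => Matrix.pow_apply_nonneg hM k i j

/-- An integer matrix all of whose iterates extend to the levels of the diagram of `A`
maps the dimension group of `A` to that of `B`, preserving positive cones. -/
lemma mulVec_mem_dimGroup_of_intertwine {J : Matrix (Fin N) (Fin N) ℤ}
    (h : ∀ n, ∃ a b J', n ≤ a ∧ NonnegEntries J' ∧ B ^ b * J = J' * A ^ a)
    (hA : NonnegEntries A) {g : Fin N → ℚ}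
    (hg : g ∈ dimGroup A) : ∃ hJ : ratMat J *ᵥ g ∈ dimGroup B,
      DimNonneg A ⟨g, hg⟩ → DimNonneg B ⟨_, hJ⟩ := by
  have key : ∀ (n : ℕ) (z : Fin N → ℤ), ratMat A ^ n *ᵥ g = (fun i => (z i : ℚ)) →
      ∃ (b : ℕ) (y : Fin N → ℤ), ((∀ i, 0 ≤ z i) → ∀ i, 0 ≤ y i) ∧
        ratMat B ^ b *ᵥ (ratMat J *ᵥ g) = fun i => (y i : ℚ) := by
    intro n z hz
    obtain ⟨a, b, J', hna, hJ', hJJ'⟩ := h n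
    -- Writing `a = d + n` gives `B ^ b J g = J' A ^ d z`, which is integral, and nonnegative if `z`
    -- is.
    obtain ⟨d, rfl⟩ := Nat.exists_eq_add_of_le' hna
    refine ⟨b, (J' * A ^ d) *ᵥ z, fun hz => ((hJ'.mul (hA.pow d)).mulVec_nonneg hz), ?_⟩
    rw [mulVec_mulVec, ← ratMat_pow, ← ratMat_mul, hJJ', ← ratMat_mulVec_intCast, ← hz,
      mulVec_mulVec, ← ratMat_pow, ← ratMat_mul, Matrix.mul_assoc, ← pow_add]
  obtain ⟨n, z, hz⟩ := mem_dimGroup_iff.1 hg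
  obtain ⟨b, y, -, hy⟩ := key n z hz
  refine ⟨⟨b, y, hy⟩, ?_⟩
  rintro ⟨n, z, hz0, hz⟩
  obtain ⟨b, y, hy0, hy⟩ := key n z hz
  exact ⟨b, y, hy0 hz0, hy⟩

/-- Integer matrices `S`, `R` with `R * S = A ^ l` that map the dimension groups to each other
define isomorphisms of the dimension groups. -/
lemma exists_dimGroup_equiv (hA : A.IsPrimitive) (hAirr : Irreducible A.charpoly)
    {R S : Matrix (Fin N) (Fin N) ℤ} {l : ℕ} (hRS : R * S = A ^ l)
    (hS : ∀ g ∈ dimGroup A, ratMat S *ᵥ g ∈ dimGroup B)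
    (hR : ∀ g ∈ dimGroup B, ratMat R *ᵥ g ∈ dimGroup A) :
    ∃ φ : dimGroup A ≃+ dimGroup B, ∀ g, (φ g : Fin N → ℚ) = ratMat S *ᵥ (g : Fin N → ℚ) := by
  have hu := isUnit_ratMat_pow hA hAirr l
  -- The inverse of `S` is `A⁻ˡ R`, and `A⁻ˡ` preserves the dimension group of `A`.
  have h1 : (ratMat A ^ l)⁻¹ * ratMat R * ratMat S = 1 := by
    rw [Matrix.mul_assoc, ← ratMat_mul, hRS, ratMat_pow, nonsing_inv_mul _ hu]
  have h2 : ratMat S * ((ratMat A ^ l)⁻¹ * ratMat R) = 1 := mul_eq_one_comm.1 h1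
  let f : dimGroup A →+ dimGroup B := AddMonoidHom.mk' (fun g => ⟨ratMat S *ᵥ g, hS g g.2⟩)
    (fun a b => Subtype.ext (mulVec_add (ratMat S) (a : Fin N → ℚ) b))
  have hf : ∀ g, (f g : Fin N → ℚ) = ratMat S *ᵥ (g : Fin N → ℚ) := fun _ => rfl
  refine ⟨AddEquiv.ofBijective f ⟨fun a b hab => ?_, fun y => ?_⟩, hf⟩
  · have h3 := congrArg (fun g : dimGroup B => ((ratMat A ^ l)⁻¹ * ratMat R) *ᵥ (g : Fin N → ℚ)) hab
    simp only [hf, mulVec_mulVec, h1, one_mulVec] at h3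
    exact Subtype.ext h3
  · have hmem : ((ratMat A ^ l)⁻¹ * ratMat R) *ᵥ (y : Fin N → ℚ) ∈ dimGroup A := by
      obtain ⟨n, z, hz⟩ := mem_dimGroup_iff.1 (hR y y.2)
      refine ⟨n + l, z, ?_⟩
      rw [mulVec_mulVec, pow_add, ← Matrix.mul_assoc, Matrix.mul_assoc (ratMat A ^ n),
        mul_nonsing_inv _ hu, Matrix.mul_one, ← mulVec_mulVec, hz]
    refine ⟨⟨_, hmem⟩, Subtype.ext ?_⟩
    rw [hf, mulVec_mulVec, h2, one_mulVec]

/-- The levels of the intertwined diagrams of a `C*`-equivalence. -/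
lemma intertwine_of_seq {n m : ℕ → ℕ} {J K : ℕ → Matrix (Fin N) (Fin N) ℤ} (hn : ∀ k, 0 < n k)
    (hJ : ∀ k, NonnegEntries (J k)) (h1 : ∀ k, A ^ n k = K k * J k)
    (h2 : ∀ k, B ^ m k = J (k + 1) * K k) (l : ℕ) :
    ∃ a b J', l ≤ a ∧ NonnegEntries J' ∧ B ^ b * J 0 = J' * A ^ a := by
  -- Sliding `J` through the first `l` squares sums the exponents; as each `n i ≥ 1`, the exponent
  -- of `A` is at least `l`.
  refine ⟨∑ i ∈ Finset.range l, n i, ∑ i ∈ Finset.range l, m i, J l, ?_, hJ l, ?_⟩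
  · calc l = ∑ i ∈ Finset.range l, 1 := by simp
      _ ≤ _ := Finset.sum_le_sum fun i _ => hn i
  · induction l with
    | zero => simp
    | succ l ih =>
      rw [Finset.sum_range_succ, Finset.sum_range_succ, add_comm, pow_add, Matrix.mul_assoc, ih, h2,
        add_comm (∑ i ∈ Finset.range l, n i), pow_add, h1]
      simp only [Matrix.mul_assoc]

/-- The isomorphism is `J 0`. The sequences `K k`, `J (k + 1)` intertwine the diagrams in the
opposite direction, so `K 0` also preserves cones; as `K 0 * J 0 = A ^ n 0`, positivity of `J 0 g`
gives back that of `g`. -/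
theorem CStarEquiv.orderedDimIso (hA : A.IsPrimitive) (hAirr : Irreducible A.charpoly)
    (hB : B.IsPrimitive) (h : CStarEquiv A B) : OrderedDimIso A B := by
  obtain ⟨n, m, J, K, hn, hm, hJ, hK, h⟩ := h
  have hJ0 : ∀ l, _ := intertwine_of_seq hn hJ (fun k => (h k).1) (fun k => (h k).2)
  have hK0 : ∀ l, _ := intertwine_of_seq (J := K) (K := fun k => J (k + 1)) hm hK
    (fun k => (h k).2) (fun k => (h (k + 1)).1)
  obtain ⟨φ, hφ⟩ := exists_dimGroup_equiv (B := B) hA hAirr (h 0).1.symm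
    (fun g hg => (mulVec_mem_dimGroup_of_intertwine hJ0 hA.nonneg hg).1)
    (fun g hg => (mulVec_mem_dimGroup_of_intertwine hK0 hB.nonneg hg).1)
  refine ⟨φ, fun g => ⟨fun hg => ?_, fun hg => ?_⟩⟩
  · obtain ⟨hJg, h'⟩ := mulVec_mem_dimGroup_of_intertwine hJ0 hA.nonneg g.2
    have : φ g = ⟨_, hJg⟩ := Subtype.ext (hφ g)
    rw [this]
    exact h' hg
  · obtain ⟨hKg, h'⟩ := mulVec_mem_dimGroup_of_intertwine hK0 hB.nonneg (φ g).2
    obtain ⟨k, z, hz, hkz⟩ := h' hg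
    refine ⟨k + n 0, z, hz, ?_⟩
    rw [← hkz, pow_add, ← ratMat_pow A (n 0), (h 0).1, ratMat_mul]
    simp only [hφ, mulVec_mulVec]

/-! ### From the dimension groups to `C*`-equivalence -/

/-- A nonnegative element of the trace range scales to the trace of a nonnegative integer vector
at all sufficiently high levels. -/
lemma TraceScaled.exists_forall_ge (hB : B.IsPrimitive)
    (hBirr : Irreducible B.charpoly) (hw : IsPerronRow B w) (hwK : ∀ i, w i ∈ perronField B)
    (hc : 0 < c) (h : TraceScaled A B v w c) {x : ℝ} (hx : x ∈ traceRange A v) (hx0 : 0 ≤ x) :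
    ∃ n₀ : ℕ, ∀ n ≥ n₀, ∃ z : Fin N → ℤ, (∀ i, 0 ≤ z i) ∧
      perronRoot B ^ n * (c * x) = w ⬝ᵥ fun i => (z i : ℝ) := by
  obtain ⟨g, hg⟩ := mem_traceRange_iff.1 (h.mul_mem hx)
  obtain ⟨n₀, z, hz, hgz⟩ := (hw.dimNonneg_iff hB hBirr hwK g).2 (by rw [hg]; positivity)
  refine ⟨n₀, fun n hn => ?_⟩
  obtain ⟨d, rfl⟩ := Nat.exists_eq_add_of_le' hn
  refine ⟨B ^ d *ᵥ z, NonnegEntries.mulVec_nonneg (NonnegEntries.pow hB.nonneg d) hz, ?_⟩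
  rw [← hg, ← hw.tracePairing_pow_mulVec, pow_add, ← mulVec_mulVec, hgz, ← ratMat_pow,
    ratMat_mulVec_intCast, tracePairing_intCast]

/-- The isomorphism is given by nonnegative integer matrices on sufficiently high levels. -/
lemma TraceScaled.exists_matrix (hA : A.IsPrimitive) (hAirr : Irreducible A.charpoly)
    (hB : B.IsPrimitive) (hBirr : Irreducible B.charpoly) (hv : IsPerronRow A v)
    (hw : IsPerronRow B w) (hwK : ∀ i, w i ∈ perronField B)
    (hc : 0 < c) (h : TraceScaled A B v w c) (a b₀ : ℕ) :
    ∃ b > b₀, ∃ J, NonnegEntries J ∧ w ᵥ* J.map (Int.cast : ℤ → ℝ) =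
      (perronRoot B ^ b * c * (perronRoot A ^ a)⁻¹) • v := by
  have hpos := hA.perronRoot_pos hAirr
  have hmem : ∀ i, (perronRoot A ^ a)⁻¹ * v i ∈ traceRange A v := fun i => by
    rw [← inv_pow]
    exact mul_mem_traceRange hA hAirr hv (pow_mem (inv_perronRoot_mem_perronRing A) a)
      (apply_mem_traceRange A v i)
  choose n₀ hn₀ using fun i => h.exists_forall_ge hB hBirr hw hwK hc (hmem i)
    (mul_nonneg (inv_nonneg.2 (pow_pos hpos a).le) (hv.pos i).le)
  -- The sum passes all the thresholds at once; the `+ 1` makes levels strictly increase, so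
  -- exponents built from them are positive.
  set b := b₀ + 1 + ∑ i, n₀ i
  have hb : ∀ i, n₀ i ≤ b := fun i =>
    (Finset.single_le_sum (fun j _ => Nat.zero_le _) (Finset.mem_univ i)).trans (Nat.le_add_left _ _)
  choose z hz hwz using fun i => hn₀ i b (hb i)
  refine ⟨b, by omega, Matrix.of fun i j => z j i, fun i j => hz j i, ?_⟩
  ext j
  change w ⬝ᵥ (fun i => (z j i : ℝ)) = _ * v j
  rw [← hwz]
  ring

/-- Back-and-forth: a matrix towards a high level of `B`, then one back to a higher level of `A`,
and so on. In products the factors `c` and `c⁻¹` cancel on the eigenrows, leaving powers of the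
eigenvalue, and `IsPerronRow.matrix_ext` lifts this to matrices. -/
theorem TraceScaled.cStarEquiv (hA : A.IsPrimitive) (hAirr : Irreducible A.charpoly)
    (hB : B.IsPrimitive) (hBirr : Irreducible B.charpoly) (hv : IsPerronRow A v)
    (hvK : ∀ i, v i ∈ perronField A) (hw : IsPerronRow B w) (hwK : ∀ i, w i ∈ perronField B)
    (hc : 0 < c) (h : TraceScaled A B v w c) : CStarEquiv A B := by
  have hposA := hA.perronRoot_pos hAirr
  have hposB := hB.perronRoot_pos hBirr
  choose b hb J hJ hwJ using h.exists_matrix hA hAirr hB hBirr hv hw hwK hc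
  choose a ha K hK hvK' using
    (h.symm hc.ne').exists_matrix hB hBirr hA hAirr hw hv hvK (inv_pos.2 hc)
  -- `s k` holds the current levels of `A` and `B`; the new level of `B` is chosen first, and that
  -- of `A` depends on it.
  let s : ℕ → ℕ × ℕ := fun k =>
    Nat.rec (0, 0) (fun _ p => (a (b p.1 p.2) p.1, b p.1 p.2)) k
  have hs1 : ∀ k, (s (k + 1)).2 = b (s k).1 (s k).2 := fun _ => rfl
  have hs2 : ∀ k, (s (k + 1)).1 = a (s (k + 1)).2 (s k).1 := fun _ => rfl
  have hlt1 : ∀ k, (s k).1 < (s (k + 1)).1 := fun k => by rw [hs2]; exact ha _ _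
  have hlt2 : ∀ k, (s k).2 < (s (k + 1)).2 := fun k => by rw [hs1]; exact hb _ _
  have hJ' : ∀ k, w ᵥ* (J (s k).1 (s k).2).map (Int.cast : ℤ → ℝ) =
      (perronRoot B ^ (s (k + 1)).2 * c * (perronRoot A ^ (s k).1)⁻¹) • v := fun k => hwJ _ _
  have hK' : ∀ k, v ᵥ* (K (s (k + 1)).2 (s k).1).map (Int.cast : ℤ → ℝ) =
      (perronRoot A ^ (s (k + 1)).1 * c⁻¹ * (perronRoot B ^ (s (k + 1)).2)⁻¹) • w :=
    fun k => hvK' _ _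
  -- `K k` starts at level `(s (k + 1)).2` of `B` and `J (k + 1)` ends at `(s (k + 2)).2`, hence the
  -- shifted indices in the exponent of `B`.
  refine ⟨fun k => (s (k + 1)).1 - (s k).1, fun k => (s (k + 2)).2 - (s (k + 1)).2,
    fun k => J (s k).1 (s k).2, fun k => K (s (k + 1)).2 (s k).1,
    fun k => Nat.sub_pos_of_lt (hlt1 k), fun k => Nat.sub_pos_of_lt (hlt2 (k + 1)),
    fun k => hJ _ _, fun k => hK _ _, fun k => ⟨?_, ?_⟩⟩
  · refine hv.matrix_ext hA hAirr hvK ?_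
    rw [map_intCast_pow, vecMul_pow_eigen hv.eigen, map_intCast_mul, ← vecMul_vecMul, hK',
      smul_vecMul, hJ', smul_smul, pow_sub₀ _ hposA.ne' (hlt1 k).le]
    congr 1
    field_simp
  · refine hw.matrix_ext hB hBirr hwK ?_
    rw [map_intCast_pow, vecMul_pow_eigen hw.eigen, map_intCast_mul, ← vecMul_vecMul, hJ' (k + 1),
      smul_vecMul, hK', smul_smul, pow_sub₀ _ hposB.ne' (hlt2 (k + 1)).le]
    congr 1
    field_simp

/-! ### Fields, primes and module isomorphisms. -/

lemma traceRange_le_perronField (hvK : ∀ i, v i ∈ perronField A) {x : ℝ}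
    (hx : x ∈ traceRange A v) : x ∈ perronField A := by
  obtain ⟨g, rfl⟩ := mem_traceRange_iff.1 hx
  exact IsPerronRow.tracePairing_mem_perronField hvK g

lemma exists_mul_mem_traceRange (hA : A.IsPrimitive) (hAirr : Irreducible A.charpoly)
    (hv : IsPerronRow A v) (hvK : ∀ i, v i ∈ perronField A) {x : ℝ} (hx : x ∈ perronField A) :
    ∃ m : ℤ, 0 < m ∧ (m : ℝ) * x ∈ traceRange A v := by
  obtain ⟨i⟩ := nonempty_of_irreducible_charpoly hAirr
  obtain ⟨m, hm, h⟩ := exists_mul_mem_perronRing hA hAirr (div_mem hx (hvK i))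
  refine ⟨m, hm, ?_⟩
  have := mul_mem_traceRange hA hAirr hv h (apply_mem_traceRange A v i)
  rwa [mul_assoc, div_mul_cancel₀ _ (hv.pos i).ne'] at this

namespace TraceScaled

lemma mul_mem_perronField (hA : A.IsPrimitive) (hAirr : Irreducible A.charpoly)
    (hv : IsPerronRow A v) (hvK : ∀ i, v i ∈ perronField A) (hwK : ∀ i, w i ∈ perronField B)
    (h : TraceScaled A B v w c) {x : ℝ} (hx : x ∈ perronField A) : c * x ∈ perronField B := by
  obtain ⟨m, hm, hmx⟩ := exists_mul_mem_traceRange hA hAirr hv hvK hx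
  have h1 := traceRange_le_perronField hwK (h.mul_mem hmx)
  have hm0 : (m : ℝ) ≠ 0 := by exact_mod_cast hm.ne'
  have h2 := div_mem h1 (intCast_mem (perronField B) m)
  rwa [mul_left_comm, mul_div_cancel_left₀ _ hm0] at h2

/-- Multiplication by `c` maps one field into the other; dividing the image of `x` by the image of
`1` recovers `x`. -/
lemma perronField_le (hA : A.IsPrimitive) (hAirr : Irreducible A.charpoly)
    (hv : IsPerronRow A v) (hvK : ∀ i, v i ∈ perronField A) (hwK : ∀ i, w i ∈ perronField B)
    (hc : c ≠ 0) (h : TraceScaled A B v w c) : perronField A ≤ perronField B := by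
  intro x hx
  have h1 := h.mul_mem_perronField hA hAirr hv hvK hwK hx
  have h2 := h.mul_mem_perronField hA hAirr hv hvK hwK (one_mem _)
  have h3 := div_mem h1 h2
  rwa [mul_one, mul_div_cancel_left₀ _ hc] at h3

/-- Each of the eigenvalues divides a power of the other. -/
lemma exists_isIntegral (hA : A.IsPrimitive) (hAirr : Irreducible A.charpoly)
    (hBirr : Irreducible B.charpoly) (hv : IsPerronRow A v)
    (hw : IsPerronRow B w) (hc : c ≠ 0) (h : TraceScaled A B v w c) :
    ∃ n : ℕ, IsIntegral ℤ (perronRoot B ^ n * (perronRoot A)⁻¹) := by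
  have := nonempty_of_irreducible_charpoly hBirr
  -- `1/λ_A` acts on the range for `A`, hence on its multiple by `c`, the range for `B`.
  have hmem : ∀ i, (perronRoot A)⁻¹ * w i ∈ traceRange B w := fun i => by
    have h1 := h.mul_mem (mul_mem_traceRange hA hAirr hv (inv_perronRoot_mem_perronRing A)
      ((h.symm hc).mul_mem (apply_mem_traceRange B w i)))
    rwa [mul_left_comm (perronRoot A)⁻¹, mul_inv_cancel_left₀ hc] at h1
  choose n z hz using fun i => exists_pow_mul_eq_intCast hw (hmem i)
  have hle : ∀ i, n i ≤ ∑ j, n j := fun i =>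
    Finset.single_le_sum (fun j _ => Nat.zero_le _) (Finset.mem_univ i)
  -- With the common exponent `n`, every `λ_B ^ n λ_A⁻¹ w j` is an integer combination of the `w i`;
  -- the coefficients form an integer matrix with eigenrow `w`.
  refine ⟨∑ j, n j, isIntegral_of_vecMul hw.ne_zero (M := Matrix.of fun i j =>
    (B ^ (∑ l, n l - n j) *ᵥ z j) i) ?_⟩
  ext j
  change w ⬝ᵥ (fun i => ((B ^ (∑ l, n l - n j) *ᵥ z j) i : ℝ)) = _ * w j
  rw [← tracePairing_intCast, ← ratMat_mulVec_intCast, ratMat_pow, hw.tracePairing_pow_mulVec,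
    tracePairing_intCast, ← hz, ← mul_assoc, ← pow_add, Nat.sub_add_cancel (hle j), mul_assoc]

lemma dimModuleIso (hA : A.IsPrimitive) (hAirr : Irreducible A.charpoly)
    (hB : B.IsPrimitive) (hBirr : Irreducible B.charpoly) (hv : IsPerronRow A v)
    (hw : IsPerronRow B w) (hwK : ∀ i, w i ∈ perronField B) (h : TraceScaled A B v w c)
    (R : Subalgebra ℤ ℝ) : DimModuleIso A B R := by
  obtain ⟨φ, hφ⟩ := h
  refine ⟨φ, fun f h hfh _ g => Subtype.ext (hw.tracePairing_injective hB hBirr hwK ?_)⟩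
  rw [hφ, hv.tracePairing_aeval_invEnd hA hAirr, hw.tracePairing_aeval_invEnd hB hBirr, hφ, hfh]
  ring

end TraceScaled

/-- If `b ^ n / a` is integral, then every prime dividing `a` divides `b`. -/
lemma primesDividing_subset {F : IntermediateField ℚ ℝ} {a b : ℝ} (ha0 : a ≠ 0) (ha : a ∈ F)
    (hb : b ∈ F) (hbint : IsIntegral ℤ b) {n : ℕ} (h : IsIntegral ℤ (b ^ n * a⁻¹)) :
    primesDividing F a ⊆ primesDividing F b := by
  rintro P ⟨hP, hP0, x, hxP, hx⟩
  have hint : ∀ {y : ℝ} (hy : y ∈ F), IsIntegral ℤ y → IsIntegral ℤ (⟨y, hy⟩ : F) :=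
    fun hy hy' => (isIntegral_algHom_iff (F.val.restrictScalars ℤ) Subtype.val_injective).1 hy'
  let y : NumberField.RingOfIntegers F := ⟨⟨b, hb⟩, hint hb hbint⟩
  let z : NumberField.RingOfIntegers F :=
    ⟨⟨b ^ n * a⁻¹, mul_mem (pow_mem hb n) (inv_mem ha)⟩, hint _ h⟩
  have hyz : y ^ n = z * x := by
    apply NumberField.RingOfIntegers.coe_injective
    apply Subtype.val_injective
    rw [map_pow, map_mul]
    change b ^ n = b ^ n * a⁻¹ * (algebraMap (NumberField.RingOfIntegers F) F x : ℝ)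
    rw [hx, inv_mul_cancel_right₀ ha0]
  exact ⟨hP, hP0, y, hP.mem_of_pow_mem n (hyz ▸ P.mul_mem_left z hxP), rfl⟩

theorem TraceScaled.sameAlgebraicPrimes (hA : A.IsPrimitive) (hAirr : Irreducible A.charpoly)
    (hB : B.IsPrimitive) (hBirr : Irreducible B.charpoly) (hv : IsPerronRow A v)
    (hw : IsPerronRow B w) (hc : c ≠ 0) (h : TraceScaled A B v w c) :
    SameAlgebraicPrimes A B := by
  have hmA : perronRoot A ∈ perronField A ⊔ perronField B :=
    (le_sup_left : perronField A ≤ _) (perronRoot_mem_perronField A)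
  have hmB : perronRoot B ∈ perronField A ⊔ perronField B :=
    (le_sup_right : perronField B ≤ _) (perronRoot_mem_perronField B)
  obtain ⟨n, hn⟩ := h.exists_isIntegral hA hAirr hBirr hv hw hc
  obtain ⟨m, hm⟩ := (h.symm hc).exists_isIntegral hB hBirr hAirr hw hv (inv_ne_zero hc)
  exact (primesDividing_subset (hA.perronRoot_pos hAirr).ne' hmA hmB
    (isIntegral_perronRoot hB hBirr) hn).antisymm
    (primesDividing_subset (hB.perronRoot_pos hBirr).ne' hmB hmA (isIntegral_perronRoot hA hAirr) hm)

/-- An isomorphism over a subring of full rank is multiplication by a number. -/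
theorem DimModuleIso.exists_traceScaled (hA : A.IsPrimitive) (hAirr : Irreducible A.charpoly)
    (hB : B.IsPrimitive) (hBirr : Irreducible B.charpoly) (hv : IsPerronRow A v)
    (hvK : ∀ i, v i ∈ perronField A) (hw : IsPerronRow B w) (hwK : ∀ i, w i ∈ perronField B)
    {R : Subalgebra ℤ ℝ} (hR : R ≤ perronRing A ⊓ perronRing B)
    (hspan : ∀ x ∈ perronField A, ∃ m : ℤ, 0 < m ∧ (m : ℝ) * x ∈ R) (h : DimModuleIso A B R) :
    ∃ c : ℝ, 0 < c ∧ TraceScaled A B v w c := by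
  obtain ⟨φ, hφ⟩ := h
  obtain ⟨i⟩ := nonempty_of_irreducible_charpoly hAirr
  obtain ⟨g₀, hg₀⟩ := mem_traceRange_iff.1 (apply_mem_traceRange A v i)
  have hv0 : tracePairing v g₀ ≠ 0 := hg₀ ▸ (hv.pos i).ne'
  have hw0 : tracePairing w (φ g₀) ≠ 0 := by
    intro h0
    have h1 : φ g₀ = 0 := Subtype.ext (hw.tracePairing_injective hB hBirr hwK (by simpa using h0))
    rw [map_eq_zero_iff φ φ.injective] at h1
    exact hv0 (by simp [h1])
  have hs : TraceScaled A B v w (tracePairing w (φ g₀) / tracePairing v g₀) := by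
    refine ⟨φ, fun g => ?_⟩
    -- Rank one: `r = m τ(g) / τ(g₀)` lies in `R` for some `m > 0`, so `m g = r g₀`. Linearity over
    -- `R` transports this to `B`, and the factor is the one read off at `g₀`.
    obtain ⟨m, hm, hmR⟩ := hspan (tracePairing v g / tracePairing v g₀)
      (div_mem (IsPerronRow.tracePairing_mem_perronField hvK g)
        (IsPerronRow.tracePairing_mem_perronField hvK g₀))
    obtain ⟨f, hf⟩ := mem_perronRing_iff.1 (hR hmR).1
    obtain ⟨k, hk⟩ := mem_perronRing_iff.1 (hR hmR).2
    have h1 := hφ f k (hf.trans hk.symm) (hf ▸ hmR) g₀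
    have h2 : Polynomial.aeval (invEnd A) f g₀ = m • g := by
      refine Subtype.ext (hv.tracePairing_injective hA hAirr hvK ?_)
      rw [hv.tracePairing_aeval_invEnd hA hAirr, hf, mul_assoc, div_mul_cancel₀ _ hv0,
        Submodule.coe_smul, map_smul, zsmul_eq_mul]
    rw [h2, map_zsmul] at h1
    have h3 : tracePairing w ((m • φ g : dimGroup B) : Fin N → ℚ) =
        tracePairing w (Polynomial.aeval (invEnd B) k (φ g₀) : dimGroup B) := by rw [h1]
    rw [Submodule.coe_smul, map_smul, zsmul_eq_mul, hw.tracePairing_aeval_invEnd hB hBirr, hk] at h3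
    have hm0 : (m : ℝ) ≠ 0 := by exact_mod_cast hm.ne'
    rw [mul_assoc] at h3
    rw [mul_left_cancel₀ hm0 h3]
    ring
  exact hs.exists_pos (div_ne_zero hw0 hv0)

lemma exists_mul_mem_inf (hA : A.IsPrimitive) (hAirr : Irreducible A.charpoly)
    (hB : B.IsPrimitive) (hBirr : Irreducible B.charpoly) (hK : perronField A = perronField B)
    {x : ℝ} (hx : x ∈ perronField A) :
    ∃ m : ℤ, 0 < m ∧ (m : ℝ) * x ∈ perronRing A ⊓ perronRing B := by
  obtain ⟨m, hm, h1⟩ := exists_mul_mem_perronRing hA hAirr hx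
  obtain ⟨k, hk, h2⟩ := exists_mul_mem_perronRing hB hBirr (hK ▸ hx)
  refine ⟨k * m, mul_pos hk hm, ?_, ?_⟩
  · rw [Int.cast_mul, mul_assoc]
    exact mul_mem (intCast_mem (perronRing A) k) h1
  · rw [Int.cast_mul, mul_comm (k : ℝ), mul_assoc]
    exact mul_mem (intCast_mem (perronRing B) m) h2

/-- A subring of a number field has full rank if it contains a multiple of each element. -/
lemma finrank_eq_of_forall_exists_mul_mem {K : IntermediateField ℚ ℝ} {R : Subalgebra ℤ ℝ}
    (hR : ∀ x ∈ R, x ∈ K) (hspan : ∀ x ∈ K, ∃ m : ℤ, 0 < m ∧ (m : ℝ) * x ∈ R) :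
    Module.finrank ℤ R = Module.finrank ℚ K := by
  let f : R →ₗ[ℤ] K :=
    { toFun := fun x => ⟨x, hR x x.2⟩
      map_add' := fun _ _ => rfl
      map_smul' := fun a x => Subtype.ext (by simp) }
  have hinj : Function.Injective f := fun x y h => Subtype.ext (Subtype.mk.inj h)
  -- `K` is the localization of `R` at the nonzero integers, and localization preserves rank.
  have hf : IsLocalizedModule (nonZeroDivisors ℤ) f :=
    { map_units := fun s => by
        rw [Module.End.isUnit_iff]
        have hs : ((s : ℤ) : K) ≠ 0 := by
          exact_mod_cast nonZeroDivisors.ne_zero s.2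
        refine ⟨fun a b hab => ?_, fun b => ⟨((s : ℤ) : K)⁻¹ * b, ?_⟩⟩
        · simp only [Module.algebraMap_end_apply, zsmul_eq_mul] at hab
          exact mul_left_cancel₀ hs hab
        · simp only [Module.algebraMap_end_apply, zsmul_eq_mul]
          exact mul_inv_cancel_left₀ hs b
      surj := fun y => by
        obtain ⟨m, hm, h⟩ := hspan y y.2
        refine ⟨⟨⟨_, h⟩, ⟨m, mem_nonZeroDivisors_of_ne_zero hm.ne'⟩⟩, Subtype.ext ?_⟩
        simp [f, Submonoid.smul_def]
      exists_of_eq := fun {x y} hxy => ⟨1, by rw [hinj hxy]⟩ }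
  rw [← IsLocalizedModule.finrank_eq (nonZeroDivisors ℤ) f le_rfl,
    IsFractionRing.finrank_right_eq ℤ ℚ]

/-- A subring of full rank of a number field contains a multiple of each element. -/
lemma exists_mul_mem_of_finrank_eq {K : IntermediateField ℚ ℝ} {R : Subalgebra ℤ ℝ} {N : ℕ}
    (hN : 0 < N) (hK : Module.finrank ℚ K = N) (hR : ∀ x ∈ R, x ∈ K)
    (hrank : Module.finrank ℤ R = N) {x : ℝ} (hx : x ∈ K) :
    ∃ m : ℤ, 0 < m ∧ (m : ℝ) * x ∈ R := by
  have : FiniteDimensional ℚ K := Module.finite_of_finrank_pos (hK ▸ hN)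
  obtain ⟨b, hb⟩ := exists_linearIndependent_of_le_finrank hrank.ge
  let f : R →ₗ[ℤ] K :=
    { toFun := fun x => ⟨x, hR x x.2⟩
      map_add' := fun _ _ => rfl
      map_smul' := fun a x => Subtype.ext (by simp) }
  have hf : Function.Injective f := fun x y h => Subtype.ext (Subtype.mk.inj h)
  -- Independence over `ℤ` persists over `ℚ`, so `b` becomes a basis of `K`; the product of the
  -- denominators of the coordinates of `x` is the required multiplier.
  have hb1 : LinearIndependent ℚ (f ∘ b) :=
    (LinearIndependent.iff_fractionRing ℤ ℚ).1 (hb.map' f (LinearMap.ker_eq_bot.2 hf))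
  have htop := hb1.span_eq_top_of_card_eq_finrank' (by rw [Fintype.card_fin, hK])
  obtain ⟨q, hq⟩ := (Submodule.mem_span_range_iff_exists_fun ℚ).1
    (htop ▸ Submodule.mem_top : (⟨x, hx⟩ : K) ∈ _)
  have hq' : x = ∑ i, (q i : ℝ) * (b i : ℝ) := by
    have := congrArg (K.val) hq
    simp only [map_sum, Algebra.smul_def, map_mul] at this
    exact this.symm
  refine ⟨∏ i, ((q i).den : ℤ), Finset.prod_pos fun i _ => by exact_mod_cast (q i).pos, ?_⟩
  rw [hq', Finset.mul_sum]
  refine sum_mem fun i _ => ?_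
  rw [← Finset.prod_erase_mul _ _ (Finset.mem_univ i), Int.cast_mul, mul_assoc, ← mul_assoc _ (q i : ℝ)]
  have : (((q i).den : ℤ) : ℝ) * (q i : ℝ) = ((q i).num : ℝ) := by
    exact_mod_cast Rat.den_mul_eq_num (q i)
  rw [this]
  exact mul_mem (intCast_mem R _) (mul_mem (intCast_mem R _) (b i).2)

/-! ### Equal characteristic polynomials -/

lemma perronRoot_eq_of_charpoly_eq (h : A.charpoly = B.charpoly) :
    perronRoot A = perronRoot B := by
  have h1 : (A.map (Int.cast : ℤ → ℂ)).charpoly = _ := charpoly_map A (Int.castRingHom ℂ)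
  have h2 : (B.map (Int.cast : ℤ → ℂ)).charpoly = _ := charpoly_map B (Int.castRingHom ℂ)
  have : spectrum ℂ (A.map (Int.cast : ℤ → ℂ)) = spectrum ℂ (B.map (Int.cast : ℤ → ℂ)) := by
    ext μ
    rw [Matrix.mem_spectrum_iff_isRoot_charpoly, Matrix.mem_spectrum_iff_isRoot_charpoly, h1, h2, h]
  rw [perronRoot, perronRoot, spectralRadius, spectralRadius, this]

/-- With a common `λ`, matrices with `w S = λ ^ b c v` and `v R = λ ^ a c⁻¹ w` satisfy all four
equations on the eigenrows, with lag `a + b`. -/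
theorem TraceScaled.shiftEquiv (hA : A.IsPrimitive) (hAirr : Irreducible A.charpoly)
    (hB : B.IsPrimitive) (hBirr : Irreducible B.charpoly) (hv : IsPerronRow A v)
    (hvK : ∀ i, v i ∈ perronField A) (hw : IsPerronRow B w) (hwK : ∀ i, w i ∈ perronField B)
    (hroot : perronRoot A = perronRoot B) (hc : 0 < c) (h : TraceScaled A B v w c) :
    ShiftEquiv A B := by
  have hpos := hA.perronRoot_pos hAirr
  obtain ⟨b, hb, S, hS, hwS⟩ := h.exists_matrix hA hAirr hB hBirr hv hw hwK hc 0 0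
  obtain ⟨a, ha, R, hR, hvR⟩ := (h.symm hc.ne').exists_matrix hB hBirr hA hAirr hw hv hvK
    (inv_pos.2 hc) 0 0
  rw [← hroot] at hwS
  rw [← hroot] at hvR
  have hBw := hw.eigen
  rw [← hroot] at hBw
  refine ⟨R, S, a + b, hR, hS, by omega, hv.matrix_ext hA hAirr hvK ?_,
    hw.matrix_ext hB hBirr hwK ?_, hv.matrix_ext hA hAirr hvK ?_, hw.matrix_ext hB hBirr hwK ?_⟩
  · rw [map_intCast_mul, map_intCast_mul, ← vecMul_vecMul, ← vecMul_vecMul, hv.eigen, smul_vecMul,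
      hvR, smul_vecMul, hBw, smul_comm]
  · rw [map_intCast_mul, map_intCast_mul, ← vecMul_vecMul, ← vecMul_vecMul, hBw, smul_vecMul,
      hwS, smul_vecMul, hv.eigen, smul_comm]
  · rw [map_intCast_mul, ← vecMul_vecMul, hvR, smul_vecMul, hwS, map_intCast_pow,
      vecMul_pow_eigen hv.eigen, smul_smul]
    congr 1
    field_simp
    ring
  · rw [map_intCast_mul, ← vecMul_vecMul, hwS, smul_vecMul, hvR, map_intCast_pow,
      vecMul_pow_eigen hBw, smul_smul]
    congr 1
    field_simp
    ring

lemma mulVec_mem_dimGroup_of_mul_eq {S : Matrix (Fin N) (Fin N) ℤ} (h : S * A = B * S)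
    {g : Fin N → ℚ} (hg : g ∈ dimGroup A) : ratMat S *ᵥ g ∈ dimGroup B := by
  have hpow : ∀ n, B ^ n * S = S * A ^ n := fun n => by
    induction n with
    | zero => simp
    | succ n ih => rw [pow_succ, Matrix.mul_assoc, ← h, ← Matrix.mul_assoc, ih, Matrix.mul_assoc,
        ← pow_succ]
  obtain ⟨n, z, hz⟩ := mem_dimGroup_iff.1 hg
  refine ⟨n, S *ᵥ z, ?_⟩
  rw [mulVec_mulVec, ← ratMat_pow, ← ratMat_mul, hpow, ratMat_mul, ← mulVec_mulVec, ratMat_pow, hz,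
    ratMat_mulVec_intCast]

/-- The row `w S` is an eigenrow of `A` for the common root, hence `c v`. Here `c` may be negative,
but not zero, since the trace by `w` does not vanish on the dimension group of `B`. -/
theorem ShiftEquivInt.exists_traceScaled (hA : A.IsPrimitive) (hAirr : Irreducible A.charpoly)
    (hv : IsPerronRow A v) (hw : IsPerronRow B w)
    (hroot : perronRoot A = perronRoot B) (h : ShiftEquivInt A B) :
    ∃ c : ℝ, 0 < c ∧ TraceScaled A B v w c := by
  obtain ⟨R, S, l, -, h1, h2, h3, -⟩ := h
  obtain ⟨φ, hφ⟩ := exists_dimGroup_equiv (B := B) hA hAirr h3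
    (fun g => mulVec_mem_dimGroup_of_mul_eq h2) (fun g => mulVec_mem_dimGroup_of_mul_eq h1.symm)
  have hwS : (w ᵥ* S.map (Int.cast : ℤ → ℝ)) ᵥ* A.map (Int.cast : ℤ → ℝ) =
      perronRoot A • (w ᵥ* S.map (Int.cast : ℤ → ℝ)) := by
    rw [vecMul_vecMul, ← map_intCast_mul, h2, map_intCast_mul, ← vecMul_vecMul, hw.eigen,
      smul_vecMul, hroot]
  obtain ⟨c, hc⟩ := hv.exists_eq_smul hA hwS
  have hs : TraceScaled A B v w c :=
    ⟨φ, fun g => by rw [hφ, tracePairing_ratMat_mulVec, hc, tracePairing_smul_left]⟩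
  refine hs.exists_pos ?_
  rintro rfl
  obtain ⟨i⟩ := nonempty_of_irreducible_charpoly hAirr
  obtain ⟨φ, hφ⟩ := hs
  obtain ⟨g, hg⟩ := mem_traceRange_iff.1 (apply_mem_traceRange B w i)
  have h5 := hφ (φ.symm g)
  rw [φ.apply_symm_apply, hg, zero_mul] at h5
  exact (hw.pos i).ne' h5

/-! ### Powers -/

lemma dimGroup_pow (A : Matrix (Fin N) (Fin N) ℤ) {k : ℕ} (hk : 0 < k) :
    dimGroup (A ^ k) = dimGroup A := by
  ext g
  constructor
  · rintro ⟨n, z, hz⟩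
    exact ⟨k * n, z, by rw [pow_mul, ← ratMat_pow, hz]⟩
  · rintro ⟨n, z, hz⟩
    obtain ⟨d, hd⟩ := Nat.exists_eq_add_of_le' (Nat.le_mul_of_pos_left n hk)
    refine ⟨n, A ^ d *ᵥ z, ?_⟩
    rw [ratMat_pow, ← pow_mul, hd, pow_add, ← mulVec_mulVec, hz, ← ratMat_pow,
      ratMat_mulVec_intCast]

lemma IsPerronRow.pow [Nonempty (Fin N)] (hA : A.IsPrimitive) (hv : IsPerronRow A v) (k : ℕ) :
    IsPerronRow (A ^ k) v := by
  have h : v ᵥ* (A ^ k).map (Int.cast : ℤ → ℝ) = perronRoot A ^ k • v := by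
    rw [map_intCast_pow, vecMul_pow_eigen hv.eigen]
  refine ⟨hv.pos, ?_⟩
  rw [perronRoot_eq (NonnegEntries.pow hA.nonneg k) hv.pos h, h]

lemma traceRange_pow (A : Matrix (Fin N) (Fin N) ℤ) (v : Fin N → ℝ) {k : ℕ} (hk : 0 < k) :
    traceRange (A ^ k) v = traceRange A v := by
  rw [traceRange, dimGroup_pow A hk, traceRange]

theorem theorem7p2 (N : ℕ) (A B : Matrix (Fin N) (Fin N) ℤ)
    (hA : A.IsPrimitive) (hB : B.IsPrimitive)
    (hA_irr : Irreducible A.charpoly) (hB_irr : Irreducible B.charpoly) :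
    -- C*-equivalence is the conjunction of the three conditions; the module isomorphism may be
    -- taken over all of the common ring or just over some subring of full rank
    (CStarEquiv A B ↔
      perronField A = perronField B ∧ SameAlgebraicPrimes A B ∧
        DimModuleIso A B (perronRing A ⊓ perronRing B)) ∧
    (CStarEquiv A B ↔
      perronField A = perronField B ∧ SameAlgebraicPrimes A B ∧
        ∃ R : Subalgebra ℤ ℝ, R ≤ perronRing A ⊓ perronRing B ∧ Module.finrank ℤ R = N ∧
          DimModuleIso A B R) ∧
    -- the dimension groups are fractional ideals by means of the trace
    (∀ C : Matrix (Fin N) (Fin N) ℤ, C = A ∨ C = B →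
      (∃ v, IsPerronRow C v ∧ ∀ i, v i ∈ perronRing C) ∧
      ∀ v, IsPerronRow C v → (∀ i, v i ∈ perronField C) → TraceIsModuleIso C v) ∧
    -- the three conditions amount to an order isomorphism of the ranges of the traces
    (∀ v w : Fin N → ℝ, IsPerronRow A v → (∀ i, v i ∈ perronField A) →
      IsPerronRow B w → (∀ i, w i ∈ perronField B) →
      ((perronField A = perronField B ∧ SameAlgebraicPrimes A B ∧
          DimModuleIso A B (perronRing A ⊓ perronRing B)) ↔
        Nonempty (traceRange A v ≃+o traceRange B w))) ∧
    -- equal characteristic polynomials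
    (A.charpoly = B.charpoly →
      List.TFAE [CStarEquiv A B, OrderedDimIso A B, ShiftEquiv A B, ShiftEquivInt A B]) ∧
    -- powers of the matrix have the same module and the same ideal
    (∀ k : ℕ, 0 < k → dimGroup (A ^ k) = dimGroup A ∧
      ∀ v, IsPerronRow A v → IsPerronRow (A ^ k) v ∧ traceRange (A ^ k) v = traceRange A v) := by
  have hne := nonempty_of_irreducible_charpoly hA_irr
  have hN : 0 < N := Fin.pos_iff_nonempty.2 hne
  have hrank := finrank_perronField hA hA_irr
  have hring : ∀ x ∈ perronRing A ⊓ perronRing B, x ∈ perronField A :=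
    fun x hx => perronRing_le_perronField hx.1
  have conditions : ∀ {v w : Fin N → ℝ} {c : ℝ}, IsPerronRow A v → (∀ i, v i ∈ perronField A) →
      IsPerronRow B w → (∀ i, w i ∈ perronField B) → 0 < c → TraceScaled A B v w c →
      perronField A = perronField B ∧ SameAlgebraicPrimes A B ∧
        DimModuleIso A B (perronRing A ⊓ perronRing B) := by
    intro v w c hv hvK hw hwK hc h
    exact ⟨(h.perronField_le hA hA_irr hv hvK hwK hc.ne').antisymm
      ((h.symm hc.ne').perronField_le hB hB_irr hw hwK hvK (inv_ne_zero hc.ne')),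
      h.sameAlgebraicPrimes hA hA_irr hB hB_irr hv hw hc.ne',
      h.dimModuleIso hA hA_irr hB hB_irr hv hw hwK _⟩
  obtain ⟨v, hv, hvR⟩ := exists_isPerronRow_mem_perronRing hA hA_irr
  obtain ⟨w, hw, hwR⟩ := exists_isPerronRow_mem_perronRing hB hB_irr
  have hvK := fun i => perronRing_le_perronField (hvR i)
  have hwK := fun i => perronRing_le_perronField (hwR i)
  have horder := orderedDimIso_iff_traceScaled hA hA_irr hB hB_irr hv hvK hw hwK
  have hcstar : CStarEquiv A B ↔ ∃ c : ℝ, 0 < c ∧ TraceScaled A B v w c :=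
    ⟨fun h => horder.1 (h.orderedDimIso hA hA_irr hB),
      fun ⟨_, hc, h⟩ => h.cStarEquiv hA hA_irr hB hB_irr hv hvK hw hwK hc⟩
  refine ⟨?_, ?_, ?_, ?_, ?_, ?_⟩
  · rw [hcstar]
    refine ⟨fun ⟨c, hc, h⟩ => conditions hv hvK hw hwK hc h, fun ⟨h1, _, h3⟩ => ?_⟩
    exact h3.exists_traceScaled hA hA_irr hB hB_irr hv hvK hw hwK le_rfl
      fun x hx => exists_mul_mem_inf hA hA_irr hB hB_irr h1 hx
  · rw [hcstar]
    refine ⟨fun ⟨c, hc, h⟩ => ?_, fun ⟨_, _, R, hR, hRN, h3⟩ => ?_⟩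
    · obtain ⟨h1, h2, h3⟩ := conditions hv hvK hw hwK hc h
      -- The full common ring serves as `R`: once the fields agree it contains a positive integer
      -- multiple of each field element, so its rank is `N`.
      refine ⟨h1, h2, _, le_rfl, ?_, h3⟩
      rw [finrank_eq_of_forall_exists_mul_mem hring
        fun x hx => exists_mul_mem_inf hA hA_irr hB hB_irr h1 hx, hrank]
    · exact h3.exists_traceScaled hA hA_irr hB hB_irr hv hvK hw hwK hR
        fun x hx => exists_mul_mem_of_finrank_eq hN hrank (fun y hy => hring y (hR hy)) hRN hx
  · rintro C (rfl | rfl)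
    · exact ⟨⟨v, hv, hvR⟩, fun u hu huK => hu.traceIsModuleIso hA hA_irr huK⟩
    · exact ⟨⟨w, hw, hwR⟩, fun u hu huK => hu.traceIsModuleIso hB hB_irr huK⟩
  · intro v' w' hv' hvK' hw' hwK'
    rw [nonempty_traceRange_orderIso_iff hA hA_irr hB hB_irr hv' hvK' hw' hwK']
    refine ⟨fun ⟨h1, _, h3⟩ => ?_, fun ⟨c, hc, h⟩ => conditions hv' hvK' hw' hwK' hc h⟩
    exact h3.exists_traceScaled hA hA_irr hB hB_irr hv' hvK' hw' hwK' le_rfl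
      fun x hx => exists_mul_mem_inf hA hA_irr hB hB_irr h1 hx
  · intro hchar
    have hroot := perronRoot_eq_of_charpoly_eq hchar
    tfae_have 1 ↔ 2 := hcstar.trans horder.symm
    tfae_have 2 → 3 := fun h => by
      obtain ⟨c, hc, h⟩ := horder.1 h
      exact h.shiftEquiv hA hA_irr hB hB_irr hv hvK hw hwK hroot hc
    tfae_have 3 → 4 := fun ⟨R, S, l, _, _, h⟩ => ⟨R, S, l, h⟩
    tfae_have 4 → 2 := fun h =>
      horder.2 (h.exists_traceScaled hA hA_irr hv hw hroot)
    tfae_finish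
  · exact fun k hk => ⟨dimGroup_pow A hk, fun u hu => ⟨hu.pow hA k, traceRange_pow A u hk⟩⟩
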